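/- Let $n\ge 1$, $\sigma_1\ge\sigma_2>0$, $L>0$, $r>0$, and put $x_1^*=(-r,0,\dots,0)$, $x_2^*=(r,0,\dots,0)$ in $\mathbb{R}^n$ with the Euclidean norm; write $x_1$ for the first coordinate of $x$. Let $\mathcal{B}_i=\{x:\|x-x_i^*\|<L/\sigma_i\}$. Define $$\tilde\phi_i(x)=\arccos\Big(\frac{\sigma_i}{L}\|x-x_i^*\|\Big)\ \ (x\in\overline{\mathcal B}_i),\qquad \alpha_i(x)=\angle(x-x_i^*,\,x_2^*-x_1^*)\in[0,\pi]\ \ (x\ne x_i^*),$$ $$\psi(x)=\pi-(\alpha_2(x)-\alpha_1(x))\ \ (x\ne x_1^*,x_2^*),$$ and, with $x$ ranging over the common domain $(\overline{\mathcal B}_1\cap\overline{\mathcal B}_2)\setminus\{x_1^*,x_2^*\}$ of these functions, $$\mathcal M^{\uparrow}=\{x:\tilde\phi_1(x)+\tilde\phi_2(x)\ge\psi(x)\},\qquad \widetilde{\mathcal T}=\{x:\tilde\phi_1(x)+\tilde\phi_2(x)>\psi(x)\}.$$ With $d_i(x)=\|x-x_i^*\|$, let $\mathcal T$ be the set of $x\in\mathbb{R}^n$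 with $d_i(x)\neq 0$ and $1/d_i^2(x)\ge\sigma_i^2/L^2$ for $i=1,2$, and $$\frac{\|x\|^2-r^2}{d_1^2(x)\,d_2^2(x)}+\frac{\sigma_1\sigma_2}{L^2}=\sqrt{\frac1{d_1^2(x)}-\frac{\sigma_1^2}{L^2}}\cdot\sqrt{\frac1{d_2^2(x)}-\frac{\sigma_2^2}{L^2}}.$$ Put $\gamma_i=L^2/\sigma_i^2$, $\beta=\sigma_2/\sigma_1$, $$\lambda_1=\Big(\frac{1+\beta}{1+2\beta}\Big)\frac{\gamma_1}{2r}-\frac{r}{1+2\beta},\qquad \lambda_2=-\Big(\frac{1+\beta}{2+\beta}\Big)\frac{\gamma_2}{2r}+\frac{\beta r}{2+\beta},$$ and $\mathcal H_1^-=\{x:x_1\le\lambda_1\}$, $\mathcal H_2^+=\{x:x_1\ge\lambda_2\}$. Write $\partial$ for the topological boundary, ${}^\circ$ for the interior, ${}^c$ for the complement in $\mathbb{R}^n$, and $\sqcup$ for a union of pairwise disjoint sets (the disjointness is part of the claim). Then: (i) If $0<r\le\frac{L}{2\sigma_1}$, then $\mathcal M^\uparrow\sqcup\{x_1^*,x_2^*\}$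 is closed, $\partial\mathcal M^\uparrow=\mathcal T\sqcup\{x_1^*,x_2^*\}$, and $(\mathcal M^\uparrow)^\circ=\widetilde{\mathcal T}$. (ii) If $\frac{L}{2\sigma_1}<r\le\frac{L}{2\sigma_2}$, then $\mathcal M^\uparrow\sqcup\{x_1^*\}$ is closed, $$\partial\mathcal M^\uparrow=[\partial\mathcal B_1\cap(\mathcal H_1^-)^c]\sqcup\mathcal T\sqcup\{x_1^*\},\qquad (\mathcal M^\uparrow)^\circ=[\mathcal B_1\cap(\mathcal H_1^-)^c]\sqcup[\widetilde{\mathcal T}\cap\mathcal H_1^-].$$ (iii) If $\frac{L}{2\sigma_2}<r<\frac L2\big(\frac1{\sigma_1}+\frac1{\sigma_2}\big)$, then $\mathcal M^\uparrow$ is closed, $$\partial\mathcal M^\uparrow=[\partial\mathcal B_1\cap(\mathcal H_1^-)^c]\sqcup[\partial\mathcal B_2\cap(\mathcal H_2^+)^c]\sqcup\mathcal T,$$ $$(\mathcal M^\uparrow)^\circ=[\mathcal B_1\cap(\mathcal H_1^-)^c]\sqcup[\mathcal B_2\cap(\mathcal H_2^+)^c]\sqcup[\widetilde{\mathcal T}\cap(\mathcal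 H_1^-\cap\mathcal H_2^+)].$$ (iv) If $r=\frac L2\big(\frac1{\sigma_1}+\frac1{\sigma_2}\big)$, then $\mathcal M^\uparrow=\big\{\big(\frac L2\big(\frac1{\sigma_1}-\frac1{\sigma_2}\big),0,\dots,0\big)\big\}$. (v) If $r>\frac L2\big(\frac1{\sigma_1}+\frac1{\sigma_2}\big)$, then $\mathcal M^\uparrow=\emptyset$. -/

import Mathlib

noncomputable section

namespace SumMinimizer

/-- `R n` is Euclidean space `ℝⁿ`. -/
abbrev R (n : ℕ) := EuclideanSpace ℝ (Fin n)

variable {n : ℕ}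

/-- The open ball `B_i` of radius `L / σ_i` around the minimizer `x_i`. -/
def ballB (xi : R n) (σ L : ℝ) : Set (R n) := Metric.ball xi (L / σ)

/-- `φ̃_i (x) = arccos ((σ_i / L) ‖x - x_i‖)`; its domain is the closed ball of radius `L / σ_i`
around `x_i`, and it is used only there. -/
def phiT (xi : R n) (σ L : ℝ) (x : R n) : ℝ := Real.arccos (σ / L * ‖x - xi‖)

/-- `α_i (x)`, the angle between `x - x_i` and `x₂ - x₁`; used only for `x ≠ x_i`. -/
def alpha (x₁ x₂ xi x : R n) : ℝ := InnerProductGeometry.angle (x - xi) (x₂ - x₁)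

/-- `ψ (x) = π - (α₂ (x) - α₁ (x))`; used only for `x ≠ x₁` and `x ≠ x₂`. -/
def psi (x₁ x₂ x : R n) : ℝ := Real.pi - (alpha x₁ x₂ x₂ x - alpha x₁ x₂ x₁ x)

/-- The common domain of `φ̃₁`, `φ̃₂` and `ψ`: the intersection of the two closed balls, without
the two points `x₁`, `x₂`. -/
def angleDom (x₁ x₂ : R n) (σ₁ σ₂ L : ℝ) : Set (R n) :=
  (Metric.closedBall x₁ (L / σ₁) ∩ Metric.closedBall x₂ (L / σ₂)) \ {x₁, x₂}

/-- The outer approximation `M↑`: the points of the common domain with `φ̃₁ + φ̃₂ ≥ ψ`. -/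
def mUp (x₁ x₂ : R n) (σ₁ σ₂ L : ℝ) : Set (R n) :=
  {x | x ∈ angleDom x₁ x₂ σ₁ σ₂ L ∧ psi x₁ x₂ x ≤ phiT x₁ σ₁ L x + phiT x₂ σ₂ L x}

/-- The set `T̃`: the points of the common domain with `φ̃₁ + φ̃₂ > ψ`. -/
def tTilde (x₁ x₂ : R n) (σ₁ σ₂ L : ℝ) : Set (R n) :=
  {x | x ∈ angleDom x₁ x₂ σ₁ σ₂ L ∧ psi x₁ x₂ x < phiT x₁ σ₁ L x + phiT x₂ σ₂ L x}

/-- The curve (hypersurface) `T`, where `d_i = ‖x - x_i‖`, given by the equation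
`(‖x‖² - r²) / (d₁² d₂²) + σ₁ σ₂ / L² = √(1 / d₁² - σ₁² / L²) √(1 / d₂² - σ₂² / L²)`
at the points where both sides make sense: denominators nonzero and radicands nonnegative. -/
def curveT (x₁ x₂ : R n) (σ₁ σ₂ L r : ℝ) : Set (R n) :=
  {x | x ≠ x₁ ∧ x ≠ x₂ ∧
    0 ≤ 1 / ‖x - x₁‖ ^ 2 - σ₁ ^ 2 / L ^ 2 ∧ 0 ≤ 1 / ‖x - x₂‖ ^ 2 - σ₂ ^ 2 / L ^ 2 ∧
    (‖x‖ ^ 2 - r ^ 2) / (‖x - x₁‖ ^ 2 * ‖x - x₂‖ ^ 2) + σ₁ * σ₂ / L ^ 2 =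
      √(1 / ‖x - x₁‖ ^ 2 - σ₁ ^ 2 / L ^ 2) * √(1 / ‖x - x₂‖ ^ 2 - σ₂ ^ 2 / L ^ 2)}

/-- `γ_i = L² / σ_i²`. -/
def gam (σ L : ℝ) : ℝ := L ^ 2 / σ ^ 2

/-- `β = σ₂ / σ₁`. -/
def bet (σ₁ σ₂ : ℝ) : ℝ := σ₂ / σ₁

/-- The abscissa `λ₁`. -/
def lam₁ (σ₁ σ₂ L r : ℝ) : ℝ :=
  (1 + bet σ₁ σ₂) / (1 + 2 * bet σ₁ σ₂) * (gam σ₁ L / (2 * r)) - r / (1 + 2 * bet σ₁ σ₂)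

/-- The abscissa `λ₂`. -/
def lam₂ (σ₁ σ₂ L r : ℝ) : ℝ :=
  -((1 + bet σ₁ σ₂) / (2 + bet σ₁ σ₂)) * (gam σ₂ L / (2 * r)) +
    bet σ₁ σ₂ * r / (2 + bet σ₁ σ₂)

/-- The closed half-space of points with first coordinate at least `c`. -/
def hPlus [NeZero n] (c : ℝ) : Set (R n) := {x | c ≤ x 0}

/-- The closed half-space of points with first coordinate at most `c`. -/
def hMinus [NeZero n] (c : ℝ) : Set (R n) := {x | x 0 ≤ c}

end SumMinimizer

end

open SumMinimizer

open SumMinimizer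

namespace SumMinimizer

/-! ### The angle condition as the sign of a continuous function -/

section

variable {n : ℕ}

/-! Both `ψ` and `φ̃₁ + φ̃₂` lie in `[0, π]`, where cosine is strictly decreasing, so comparing them
is comparing cosines. After multiplication by `d₁ d₂` the difference of cosines is the function
`gap`, which is continuous on the whole space and vanishes at both centers. On the common domain,
`M↑`, `T̃` and `T` are therefore given by `gap ≤ 0`, `gap < 0` and `gap = 0`.

Two topological facts follow. The closure of `M↑` is cut out by `d₁ ≤ L/σ₁`, `d₂ ≤ L/σ₂`, `gap ≤ 0`
(`mem_closure_mUp_iff`). If the balls overlap, the interior is given by the three strict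
inequalities (`mem_interior_mUp_iff`); the point here is that every point of `T` is a limit of
points outside `M↑` (`mem_frontier_mUp_of_mem_curveT`).

It remains to locate the spheres. On the first sphere a square root in `gap` vanishes and `gap`
becomes, up to a positive factor, affine in the first coordinate with zero at `λ₁`
(`sphere_gap_identity`). The whole cap of the closed first ball beyond `λ₁` lies in the open second
ball and has `gap < 0` (`cap_estimate`). The second sphere follows by reflection. A sphere whose
closed ball contains the other center contributes at most that center. The five cases are then a
comparison of `2r` with the radii. -/

lemma norm_sub_single_sq [NeZero n] (x : R n) (c : ℝ) :
    ‖x - EuclideanSpace.single 0 c‖ ^ 2 = ‖x‖ ^ 2 - 2 * c * x 0 + c ^ 2 := by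
  rw [norm_sub_sq_real, EuclideanSpace.inner_single_right, PiLp.norm_single]
  simp
  ring

lemma coord_sq_le [NeZero n] (x : R n) : x 0 ^ 2 ≤ ‖x‖ ^ 2 := by
  have h := EuclideanSpace.real_norm_sq_eq x
  rw [h]
  exact Finset.single_le_sum (f := fun i => x i ^ 2) (fun i _ => sq_nonneg _) (Finset.mem_univ 0)

/-- `ψ` is the supplement of the angle at `x` of the triangle `x₁ x x₂`. -/
lemma psi_eq_pi_sub_angle {x₁ x₂ x : R n} (h₁ : x ≠ x₁) :
    psi x₁ x₂ x = Real.pi - EuclideanGeometry.angle x₁ x x₂ := by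
  have h := EuclideanGeometry.angle_add_angle_add_angle_eq_pi (p₁ := x₁) (p₂ := x) x₂ h₁
  have e₁ : alpha x₁ x₂ x₁ x = EuclideanGeometry.angle x₂ x₁ x := by
    rw [EuclideanGeometry.angle_comm]; rfl
  have e₂ : alpha x₁ x₂ x₂ x = Real.pi - EuclideanGeometry.angle x x₂ x₁ := by
    unfold alpha EuclideanGeometry.angle
    rw [← InnerProductGeometry.angle_neg_right]
    simp
  unfold psi
  rw [e₁, e₂]
  linarith

lemma inner_sub_sub_of_foci [NeZero n] {r : ℝ} {x₁ x₂ : R n} (hx₁ : x₁ = EuclideanSpace.single 0 (-r))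
    (hx₂ : x₂ = EuclideanSpace.single 0 r) (x : R n) :
    inner ℝ (x₁ - x) (x₂ - x) = ‖x‖ ^ 2 - r ^ 2 := by
  have hn : x₁ = -x₂ := by
    rw [hx₁, hx₂]; ext i; by_cases h : i = 0 <;> simp [h]
  have hs : ‖x₂‖ ^ 2 = r ^ 2 := by rw [hx₂]; simp
  rw [hn, ← hs, ← real_inner_self_eq_norm_sq, ← real_inner_self_eq_norm_sq]
  simp only [inner_sub_left, inner_sub_right, inner_neg_left]
  rw [real_inner_comm x x₂]
  ring

lemma psi_eq_pi_sub_arccos [NeZero n] {r : ℝ} {x₁ x₂ x : R n} (hx₁ : x₁ = EuclideanSpace.single 0 (-r))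
    (hx₂ : x₂ = EuclideanSpace.single 0 r) (h₁ : x ≠ x₁) :
    psi x₁ x₂ x = Real.pi - Real.arccos ((‖x‖ ^ 2 - r ^ 2) / (‖x - x₁‖ * ‖x - x₂‖)) := by
  rw [psi_eq_pi_sub_angle h₁, ← inner_sub_sub_of_foci hx₁ hx₂, norm_sub_rev x x₁,
    norm_sub_rev x x₂]
  rfl

/-- A function with the sign of `ψ - φ̃₁ - φ̃₂` on the common domain. -/
noncomputable def gap (x₁ x₂ : R n) (σ₁ σ₂ L r : ℝ) (x : R n) : ℝ :=
  ‖x‖ ^ 2 - r ^ 2 + ‖x - x₁‖ * ‖x - x₂‖ *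
    (σ₁ / L * ‖x - x₁‖ * (σ₂ / L * ‖x - x₂‖) -
      √(1 - (σ₁ / L * ‖x - x₁‖) ^ 2) * √(1 - (σ₂ / L * ‖x - x₂‖) ^ 2))

lemma continuous_gap (x₁ x₂ : R n) (σ₁ σ₂ L r : ℝ) : Continuous (gap x₁ x₂ σ₁ σ₂ L r) := by
  unfold gap
  fun_prop

lemma scaled_le_one_iff {σ L d : ℝ} (hσ : 0 < σ) (hL : 0 < L) : σ / L * d ≤ 1 ↔ d ≤ L / σ := by
  rw [div_mul_eq_mul_div, div_le_one hL, le_div_iff₀ hσ, mul_comm]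

lemma mem_angleDom_iff {x₁ x₂ x : R n} {σ₁ σ₂ L : ℝ} :
    x ∈ angleDom x₁ x₂ σ₁ σ₂ L ↔
      ‖x - x₁‖ ≤ L / σ₁ ∧ ‖x - x₂‖ ≤ L / σ₂ ∧ x ≠ x₁ ∧ x ≠ x₂ := by
  simp [angleDom, dist_eq_norm, and_assoc]

section
variable {x₁ x₂ x : R n} {σ₁ σ₂ L r : ℝ}

/-- The addition formula for cosine, with the sines of the arccosines as square roots. The cosine of
`ψ` comes from the inner product of `x₁ - x` and `x₂ - x`, which is `‖x‖² - r²` because the centers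
are opposite. -/
lemma gap_eq_cos [NeZero n] (hσ₁ : 0 < σ₁) (hσ₂ : 0 < σ₂) (hL : 0 < L)
    (hx₁ : x₁ = EuclideanSpace.single 0 (-r)) (hx₂ : x₂ = EuclideanSpace.single 0 r)
    (hx : x ∈ angleDom x₁ x₂ σ₁ σ₂ L) :
    gap x₁ x₂ σ₁ σ₂ L r x = ‖x - x₁‖ * ‖x - x₂‖ *
      (Real.cos (phiT x₁ σ₁ L x + phiT x₂ σ₂ L x) - Real.cos (psi x₁ x₂ x)) := by
  obtain ⟨hd₁, hd₂, h₁, h₂⟩ := mem_angleDom_iff.1 hx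
  have hp₁ : 0 < ‖x - x₁‖ := norm_pos_iff.2 (sub_ne_zero.2 h₁)
  have hp₂ : 0 < ‖x - x₂‖ := norm_pos_iff.2 (sub_ne_zero.2 h₂)
  have e₁ : 0 ≤ σ₁ / L * ‖x - x₁‖ := by positivity
  have e₂ : 0 ≤ σ₂ / L * ‖x - x₂‖ := by positivity
  have hcos : Real.cos (psi x₁ x₂ x) = -((‖x‖ ^ 2 - r ^ 2) / (‖x - x₁‖ * ‖x - x₂‖)) := by
    rw [psi_eq_pi_sub_angle h₁, Real.cos_pi_sub, EuclideanGeometry.angle,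
      InnerProductGeometry.cos_angle, ← inner_sub_sub_of_foci hx₁ hx₂, norm_sub_rev x x₁,
      norm_sub_rev x x₂]
    rfl
  rw [hcos, Real.cos_add]
  unfold phiT gap
  rw [Real.cos_arccos (by linarith) ((scaled_le_one_iff hσ₁ hL).2 hd₁),
    Real.cos_arccos (by linarith) ((scaled_le_one_iff hσ₂ hL).2 hd₂),
    Real.sin_arccos, Real.sin_arccos]
  field_simp
  ring

lemma psi_mem_Icc (h₁ : x ≠ x₁) : psi x₁ x₂ x ∈ Set.Icc 0 Real.pi := by
  rw [psi_eq_pi_sub_angle h₁]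
  have := EuclideanGeometry.angle_nonneg x₁ x x₂
  have := EuclideanGeometry.angle_le_pi x₁ x x₂
  constructor <;> linarith

lemma phiT_add_mem_Icc (hσ₁ : 0 < σ₁) (hσ₂ : 0 < σ₂) (hL : 0 < L) :
    phiT x₁ σ₁ L x + phiT x₂ σ₂ L x ∈ Set.Icc 0 Real.pi := by
  have h₁ : phiT x₁ σ₁ L x ≤ Real.pi / 2 := Real.arccos_le_pi_div_two.2 (by positivity)
  have h₂ : phiT x₂ σ₂ L x ≤ Real.pi / 2 := Real.arccos_le_pi_div_two.2 (by positivity)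
  have h₃ : 0 ≤ phiT x₁ σ₁ L x := Real.arccos_nonneg _
  have h₄ : 0 ≤ phiT x₂ σ₂ L x := Real.arccos_nonneg _
  constructor <;> linarith

lemma mem_mUp_iff [NeZero n] (hσ₁ : 0 < σ₁) (hσ₂ : 0 < σ₂) (hL : 0 < L)
    (hx₁ : x₁ = EuclideanSpace.single 0 (-r)) (hx₂ : x₂ = EuclideanSpace.single 0 r) :
    x ∈ mUp x₁ x₂ σ₁ σ₂ L ↔ x ∈ angleDom x₁ x₂ σ₁ σ₂ L ∧ gap x₁ x₂ σ₁ σ₂ L r x ≤ 0 := by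
  refine and_congr_right fun hx => ?_
  obtain ⟨hd₁, hd₂, h₁, h₂⟩ := mem_angleDom_iff.1 hx
  have hp₁ : 0 < ‖x - x₁‖ := norm_pos_iff.2 (sub_ne_zero.2 h₁)
  have hp₂ : 0 < ‖x - x₂‖ := norm_pos_iff.2 (sub_ne_zero.2 h₂)
  have hp := mul_pos hp₁ hp₂
  rw [gap_eq_cos hσ₁ hσ₂ hL hx₁ hx₂ hx, ← Real.strictAntiOn_cos.le_iff_ge
    (phiT_add_mem_Icc hσ₁ hσ₂ hL) (psi_mem_Icc h₁), ← sub_nonpos]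
  exact ⟨mul_nonpos_of_nonneg_of_nonpos hp.le, fun h => not_lt.1 fun h' =>
    h.not_gt (mul_pos hp h')⟩

lemma mem_tTilde_iff [NeZero n] (hσ₁ : 0 < σ₁) (hσ₂ : 0 < σ₂) (hL : 0 < L)
    (hx₁ : x₁ = EuclideanSpace.single 0 (-r)) (hx₂ : x₂ = EuclideanSpace.single 0 r) :
    x ∈ tTilde x₁ x₂ σ₁ σ₂ L ↔ x ∈ angleDom x₁ x₂ σ₁ σ₂ L ∧ gap x₁ x₂ σ₁ σ₂ L r x < 0 := by
  refine and_congr_right fun hx => ?_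
  obtain ⟨hd₁, hd₂, h₁, h₂⟩ := mem_angleDom_iff.1 hx
  have hp₁ : 0 < ‖x - x₁‖ := norm_pos_iff.2 (sub_ne_zero.2 h₁)
  have hp₂ : 0 < ‖x - x₂‖ := norm_pos_iff.2 (sub_ne_zero.2 h₂)
  have hp := mul_pos hp₁ hp₂
  rw [gap_eq_cos hσ₁ hσ₂ hL hx₁ hx₂ hx, ← Real.strictAntiOn_cos.lt_iff_gt
    (phiT_add_mem_Icc hσ₁ hσ₂ hL) (psi_mem_Icc h₁), ← sub_neg]
  exact ⟨mul_neg_of_pos_of_neg hp, fun h => not_le.1 fun h' =>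
    h.not_ge (mul_nonneg hp.le h')⟩

lemma inv_sq_sub_nonneg_iff {σ L d : ℝ} (hσ : 0 < σ) (hL : 0 < L) (hd : 0 < d) :
    0 ≤ 1 / d ^ 2 - σ ^ 2 / L ^ 2 ↔ d ≤ L / σ := by
  rw [sub_nonneg, ← div_pow, ← one_div_pow, pow_le_pow_iff_left₀ (by positivity) (by positivity)
    two_ne_zero, le_div_iff₀ hd, scaled_le_one_iff hσ hL]

lemma sqrt_inv_sq_sub {σ L d : ℝ} (hd : 0 < d) :
    √(1 / d ^ 2 - σ ^ 2 / L ^ 2) = √(1 - (σ / L * d) ^ 2) / d := by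
  rw [← Real.sqrt_sq hd.le, ← Real.sqrt_div' _ (sq_nonneg d), Real.sqrt_sq hd.le]
  congr 1
  field_simp

/-- The difference of the two sides of the equation of `T` is `gap` divided by `d₁² d₂²`, and the
radicands are nonnegative exactly in the closed balls. -/
lemma mem_curveT_iff (hσ₁ : 0 < σ₁) (hσ₂ : 0 < σ₂) (hL : 0 < L) :
    x ∈ curveT x₁ x₂ σ₁ σ₂ L r ↔ x ∈ angleDom x₁ x₂ σ₁ σ₂ L ∧ gap x₁ x₂ σ₁ σ₂ L r x = 0 := by
  rw [mem_angleDom_iff]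
  simp only [curveT, Set.mem_ofPred_eq]
  by_cases h₁ : x = x₁
  · simp [h₁]
  by_cases h₂ : x = x₂
  · simp [h₂]
  have hp₁ : 0 < ‖x - x₁‖ := norm_pos_iff.2 (sub_ne_zero.2 h₁)
  have hp₂ : 0 < ‖x - x₂‖ := norm_pos_iff.2 (sub_ne_zero.2 h₂)
  rw [inv_sq_sub_nonneg_iff hσ₁ hL hp₁, inv_sq_sub_nonneg_iff hσ₂ hL hp₂, sqrt_inv_sq_sub hp₁,
    sqrt_inv_sq_sub hp₂]
  have key : (‖x‖ ^ 2 - r ^ 2) / (‖x - x₁‖ ^ 2 * ‖x - x₂‖ ^ 2) + σ₁ * σ₂ / L ^ 2 -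
      √(1 - (σ₁ / L * ‖x - x₁‖) ^ 2) / ‖x - x₁‖ * (√(1 - (σ₂ / L * ‖x - x₂‖) ^ 2) / ‖x - x₂‖) =
      gap x₁ x₂ σ₁ σ₂ L r x / (‖x - x₁‖ ^ 2 * ‖x - x₂‖ ^ 2) := by
    unfold gap
    generalize √(1 - (σ₁ / L * ‖x - x₁‖) ^ 2) = A
    generalize √(1 - (σ₂ / L * ‖x - x₂‖) ^ 2) = B
    field_simp
    ring
  rw [← sub_eq_zero, key, div_eq_zero_iff]
  have : ‖x - x₁‖ ^ 2 * ‖x - x₂‖ ^ 2 ≠ 0 := by positivity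
  tauto

end

end

/-! ### The abscissas `λ₁`, `λ₂` and two real-variable estimates -/

lemma lam₁_lt_iff {σ₁ σ₂ L r u : ℝ} (hσ₁ : 0 < σ₁) (hσ₂ : 0 < σ₂) (hL : 0 < L) (hr : 0 < r) :
    lam₁ σ₁ σ₂ L r < u ↔
      σ₁ / L + σ₂ / L - 2 * r ^ 2 * (σ₁ / L) ^ 3 <
        2 * r * (σ₁ / L) ^ 2 * (σ₁ / L + 2 * (σ₂ / L)) * u := by
  have e : 2 * r * (σ₁ / L) ^ 2 * (σ₁ / L + 2 * (σ₂ / L)) * lam₁ σ₁ σ₂ L r =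
      σ₁ / L + σ₂ / L - 2 * r ^ 2 * (σ₁ / L) ^ 3 := by
    unfold lam₁ bet gam
    have : σ₁ + 2 * σ₂ ≠ 0 := by positivity
    field_simp
  rw [← e, mul_lt_mul_iff_right₀ (by positivity)]

/-- The reflection `u ↦ -u` exchanges the two centers. Since the left-hand results do not use `σ₂ ≤
σ₁`, this transfers them to the right. -/
lemma lam₂_eq_neg_lam₁ {σ₁ σ₂ L r : ℝ} (hσ₁ : 0 < σ₁) (hσ₂ : 0 < σ₂) :
    lam₂ σ₁ σ₂ L r = -lam₁ σ₂ σ₁ L r := by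
  unfold lam₁ lam₂ bet gam
  have : 2 * σ₁ + σ₂ ≠ 0 := by positivity
  have : σ₂ + 2 * σ₁ ≠ 0 := by positivity
  field_simp
  ring

/-- In the first ball, beyond the abscissa `λ₁`, the triangle condition is strict. -/
lemma cap_estimate {s t r u P d e : ℝ} (hs : 0 < s) (ht : 0 < t) (hr : 0 < r)
    (hd : 0 ≤ d) (hdP : d ^ 2 = P + 2 * r * u + r ^ 2) (heP : e ^ 2 = P - 2 * r * u + r ^ 2)
    (hu : u ^ 2 ≤ P) (hsd : s * d ≤ 1)
    (hcap : s + t - 2 * r ^ 2 * s ^ 3 < 2 * r * s ^ 2 * (s + 2 * t) * u) :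
    t * e < 1 ∧ P - r ^ 2 + d * e * (s * d * (t * e)) < 0 := by
  -- `g` is the squared radius of the first ball. Then `g - 4ru` and `g - 2ru - 2r²` are the values
  -- of `e²` and `P - r²` at a point of the first sphere with the same abscissa `u`.
  obtain ⟨g, hg⟩ : ∃ g, g = 1 / s ^ 2 := ⟨_, rfl⟩
  have hg0 : 0 < g := by rw [hg]; positivity
  have hsg : s ^ 2 * g = 1 := by rw [hg]; field_simp
  have hdg : d ^ 2 ≤ g := by
    rw [hg, le_div_iff₀ (by positivity)]
    have := pow_le_one₀ (n := 2) (by positivity) hsd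
    nlinarith
  have hcap' : t * (g - 4 * r * u) < s * (2 * r * u + 2 * r ^ 2 - g) := by
    have h : s ^ 2 * (t * (g - 4 * r * u)) < s ^ 2 * (s * (2 * r * u + 2 * r ^ 2 - g)) := by
      have e₁ : s ^ 2 * (t * (g - 4 * r * u)) = t * (s ^ 2 * g) - 4 * r * u * t * s ^ 2 := by ring
      have e₂ : s ^ 2 * (s * (2 * r * u + 2 * r ^ 2 - g)) =
          s ^ 3 * (2 * r * u + 2 * r ^ 2) - s * (s ^ 2 * g) := by ring
      rw [e₁, e₂, hsg]
      linarith
    exact lt_of_mul_lt_mul_left h (by positivity)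
  have heE : e ^ 2 ≤ g - 4 * r * u := by linarith
  have hE0 : 0 ≤ g - 4 * r * u := (sq_nonneg e).trans heE
  -- Cauchy–Schwarz for the vectors from that sphere point to the two centers; the defect is `4r²(g
  -- - (r + u)²)`.
  have hM : (2 * r * u + 2 * r ^ 2 - g) ^ 2 ≤ g * (g - 4 * r * u) := by
    have : 0 ≤ 4 * r ^ 2 * (g - (r + u) ^ 2) := by
      have : (r + u) ^ 2 ≤ g := by nlinarith
      have : 0 ≤ g - (r + u) ^ 2 := by linarith
      positivity
    nlinarith
  refine ⟨?_, ?_⟩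
  · have hE : t ^ 2 * (g - 4 * r * u) < 1 := by
      rcases hE0.eq_or_lt with h | h
      · rw [← h]; norm_num
      · have h₁ : (t * (g - 4 * r * u)) ^ 2 < (s * (2 * r * u + 2 * r ^ 2 - g)) ^ 2 :=
          pow_lt_pow_left₀ hcap' (by positivity) two_ne_zero
        have h₂ : (g - 4 * r * u) * (t ^ 2 * (g - 4 * r * u)) < (g - 4 * r * u) * 1 := by
          have : s ^ 2 * (2 * r * u + 2 * r ^ 2 - g) ^ 2 ≤ s ^ 2 * (g * (g - 4 * r * u)) :=
            mul_le_mul_of_nonneg_left hM (by positivity)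
          rw [← mul_assoc (s ^ 2), hsg] at this
          nlinarith
        exact lt_of_mul_lt_mul_left h₂ hE0
    have : (t * e) ^ 2 < 1 := by
      have := mul_le_mul_of_nonneg_left heE (sq_nonneg t)
      nlinarith
    exact (abs_lt.1 ((sq_lt_one_iff_abs_lt_one _).1 this)).2
  -- For fixed `u` the quantity is a quadratic in `q = d²`, namely `q - 2ru - 2r² + st q(q - 4ru)`.
  -- `hk` shows that its value at `d²` is at most its value at `g`, which `hb` shows to be negative.
  · have hk : 0 ≤ (g - d ^ 2) * (s * t * (g + d ^ 2 - 4 * r * u)) := by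
      have h₁ : 0 ≤ g - d ^ 2 := by linarith
      have h₂ : 0 ≤ g + d ^ 2 - 4 * r * u := by nlinarith [sq_nonneg d]
      positivity
    have hb : g - 2 * r * u - 2 * r ^ 2 + s * t * g * (g - 4 * r * u) < 0 := by
      have h := mul_lt_mul_of_pos_left hcap' (show 0 < s * g by positivity)
      have : s * g * (s * (2 * r * u + 2 * r ^ 2 - g)) =
        (s ^ 2 * g) * (2 * r * u + 2 * r ^ 2 - g) := by ring
      rw [this, hsg] at h
      linarith
    have he : e ^ 2 = d ^ 2 - 4 * r * u := by linarith
    have : d * e * (s * d * (t * e)) = s * t * d ^ 2 * (d ^ 2 - 4 * r * u) := by rw [← he]; ring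
    rw [this]
    nlinarith

/-- On the axis the triangle condition is never an equality, unless the spheres are tangent. -/
lemma offAxis_estimate {s t r u P d e : ℝ} (hs : 0 < s) (ht : 0 < t) (hr : 0 < r)
    (hd : 0 < d) (he : 0 < e) (hdP : d ^ 2 = P + 2 * r * u + r ^ 2)
    (heP : e ^ 2 = P - 2 * r * u + r ^ 2) (hu : u ^ 2 ≤ P) (hsd : s * d ≤ 1) (hte : t * e ≤ 1)
    (htan : 2 * r < 1 / s + 1 / t)
    (hgap : P - r ^ 2 + d * e * (s * d * (t * e) - √(1 - (s * d) ^ 2) * √(1 - (t * e) ^ 2)) = 0) :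
    u ^ 2 < P := by
  refine lt_of_le_of_ne hu fun hP => ?_
  have hde : 0 < d * e := mul_pos hd he
  have hsd0 : 0 < s * d := mul_pos hs hd
  have hte0 : 0 < t * e := mul_pos ht he
  have hd' : d = |u + r| := by
    rw [← abs_of_pos hd, ← sq_eq_sq_iff_abs_eq_abs]; linarith
  have he' : e = |u - r| := by
    rw [← abs_of_pos he, ← sq_eq_sq_iff_abs_eq_abs]; linarith
  have hm : d * e = |u ^ 2 - r ^ 2| := by rw [hd', he', ← abs_mul]; congr 1; ring
  set A := √(1 - (s * d) ^ 2) with hA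
  set B := √(1 - (t * e) ^ 2) with hB
  have hA0 : 0 ≤ A := Real.sqrt_nonneg _
  have hB0 : 0 ≤ B := Real.sqrt_nonneg _
  -- On the axis `d e = |P - r²|`. Outside the open segment between the centers the gap is `d e (1 +
  -- sd·te - AB)`, which is positive. On the segment it is `d e (sd·te - AB - 1)`, and its vanishing
  -- forces `sd = te = 1`, so `2r = d + e` is the sum of the radii.
  rcases le_total 0 (u ^ 2 - r ^ 2) with h | h
  · rw [abs_of_nonneg h] at hm
    rw [← hP, ← hm] at hgap
    have hA1 : A ≤ 1 := Real.sqrt_le_one.2 (by nlinarith)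
    have hB1 : B ≤ 1 := Real.sqrt_le_one.2 (by nlinarith)
    have : A * B ≤ 1 := mul_le_one₀ hA1 hB0 hB1
    have : 0 < d * e * (1 + s * d * (t * e) - A * B) := mul_pos hde (by nlinarith)
    linarith
  · rw [abs_of_nonpos h] at hm
    have h0 : d * e * (s * d * (t * e) - A * B - 1) = 0 := by
      rw [← hgap, ← hP]; linarith
    have h1 : s * d * (t * e) - A * B - 1 = 0 := by
      rcases mul_eq_zero.1 h0 with h' | h'
      · exact absurd h' hde.ne'
      · exact h'
    have hAB : 0 ≤ A * B := mul_nonneg hA0 hB0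
    have h2 : 1 ≤ s * d := by nlinarith
    have h3 : 1 ≤ t * e := by nlinarith
    have h4 : 1 / s ≤ d := by rw [div_le_iff₀ hs]; linarith
    have h5 : 1 / t ≤ e := by rw [div_le_iff₀ ht]; linarith
    have hu' : |u| ≤ r := abs_le_of_sq_le_sq (by linarith) hr.le
    have := abs_le.1 hu'
    rw [abs_of_nonneg (by linarith)] at hd'
    rw [abs_of_nonpos (by linarith)] at he'
    linarith

/-! ### Points of `T` are boundary points -/

section

/-- Dilation by `c ≥ 1` does not widen the angle subtended by the centers. Indeed `(de)² = (P - r²)²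
+ 4r²(P - u²)`: the second term scales by exactly `c²`, while `(P - r²)²` grows by at least `c²`. -/
lemma cosine_le_of_scaled {r P u c d e d' e' : ℝ} (hc : 1 ≤ c) (hrP : r ^ 2 ≤ P)
    (hu : u ^ 2 ≤ P) (hd : 0 < d) (he : 0 < e) (hd' : 0 < d') (he' : 0 < e')
    (hdP : d ^ 2 = P + 2 * r * u + r ^ 2) (heP : e ^ 2 = P - 2 * r * u + r ^ 2)
    (hdP' : d' ^ 2 = c ^ 2 * P + 2 * r * (c * u) + r ^ 2)
    (heP' : e' ^ 2 = c ^ 2 * P - 2 * r * (c * u) + r ^ 2) :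
    (P - r ^ 2) / (d * e) ≤ (c ^ 2 * P - r ^ 2) / (d' * e') := by
  rw [div_le_div_iff₀ (by positivity) (by positivity)]
  have hN : c * (P - r ^ 2) ≤ c ^ 2 * P - r ^ 2 := by
    nlinarith [mul_nonneg (sub_nonneg.2 hc) (sq_nonneg r),
      mul_nonneg (sub_nonneg.2 hc) ((sq_nonneg r).trans hrP)]
  have h0 : 0 ≤ c * (P - r ^ 2) := mul_nonneg (by linarith) (by linarith)
  have hN' : 0 ≤ c ^ 2 * P - r ^ 2 := h0.trans hN
  refine (pow_le_pow_iff_left₀ (mul_nonneg (by linarith) (by positivity))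
    (mul_nonneg hN' (by positivity)) two_ne_zero).1 ?_
  have e₁ : (d * e) ^ 2 = (P - r ^ 2) ^ 2 + 4 * r ^ 2 * (P - u ^ 2) := by
    rw [mul_pow, hdP, heP]; ring
  have e₂ : (d' * e') ^ 2 = (c ^ 2 * P - r ^ 2) ^ 2 + 4 * r ^ 2 * (c ^ 2 * (P - u ^ 2)) := by
    rw [mul_pow, hdP', heP']; ring
  rw [mul_pow _ (d' * e'), mul_pow _ (d * e), e₁, e₂]
  have h₁ : (c * (P - r ^ 2)) ^ 2 ≤ (c ^ 2 * P - r ^ 2) ^ 2 := pow_le_pow_left₀ h0 hN 2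
  have h₂ := mul_le_mul_of_nonneg_right h₁
    (show 0 ≤ 4 * r ^ 2 * (P - u ^ 2) from mul_nonneg (by positivity) (by linarith))
  nlinarith

variable {n : ℕ} {σ₁ σ₂ L r : ℝ} {x₁ x₂ x y : R n}

lemma phiT_lt_phiT {xi : R n} {σ : ℝ} (hσ : 0 < σ) (hL : 0 < L) (hxy : ‖x - xi‖ < ‖y - xi‖)
    (hy : ‖y - xi‖ ≤ L / σ) : phiT xi σ L y < phiT xi σ L x := by
  have h : σ / L * ‖x - xi‖ < σ / L * ‖y - xi‖ := mul_lt_mul_of_pos_left hxy (by positivity)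
  have h' := (scaled_le_one_iff hσ hL).2 hy
  have h0 : 0 ≤ σ / L * ‖x - xi‖ := by positivity
  exact Real.strictAntiOn_arccos ⟨by linarith, by linarith⟩ ⟨by linarith, h'⟩ h

lemma mem_closure_of_curve {s : Set (R n)} {f : ℝ → R n} (hf : Continuous f)
    (h : ∀ t > 0, f t ∈ s) : f 0 ∈ closure s :=
  map_mem_closure hf (show (0 : ℝ) ∈ closure (Set.Ioi 0) by simp) h

variable [NeZero n]

lemma smul_single_one (c : ℝ) :
    c • (EuclideanSpace.single 0 1 : R n) = EuclideanSpace.single 0 c := by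
  ext i
  by_cases h : i = 0 <;> simp [h]

lemma sq_dist_left (hx₁ : x₁ = EuclideanSpace.single 0 (-r)) (x : R n) :
    ‖x - x₁‖ ^ 2 = ‖x‖ ^ 2 + 2 * r * x 0 + r ^ 2 := by
  rw [hx₁, norm_sub_single_sq]; ring

lemma sq_dist_right (hx₂ : x₂ = EuclideanSpace.single 0 r) (x : R n) :
    ‖x - x₂‖ ^ 2 = ‖x‖ ^ 2 - 2 * r * x 0 + r ^ 2 := by
  rw [hx₂, norm_sub_single_sq]

lemma curveT_subset_mUp (hσ₁ : 0 < σ₁) (hσ₂ : 0 < σ₂) (hL : 0 < L)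
    (hx₁ : x₁ = EuclideanSpace.single 0 (-r)) (hx₂ : x₂ = EuclideanSpace.single 0 r) :
    curveT x₁ x₂ σ₁ σ₂ L r ⊆ mUp x₁ x₂ σ₁ σ₂ L := fun x hx => by
  rw [mem_curveT_iff hσ₁ hσ₂ hL] at hx
  exact (mem_mUp_iff hσ₁ hσ₂ hL hx₁ hx₂).2 ⟨hx.1, hx.2.le⟩

lemma psi_eq_of_mem_curveT (hσ₁ : 0 < σ₁) (hσ₂ : 0 < σ₂) (hL : 0 < L)
    (hx₁ : x₁ = EuclideanSpace.single 0 (-r)) (hx₂ : x₂ = EuclideanSpace.single 0 r)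
    (hx : x ∈ curveT x₁ x₂ σ₁ σ₂ L r) :
    psi x₁ x₂ x = phiT x₁ σ₁ L x + phiT x₂ σ₂ L x := by
  refine (curveT_subset_mUp hσ₁ hσ₂ hL hx₁ hx₂ hx).2.eq_of_not_lt fun h => ?_
  rw [mem_curveT_iff hσ₁ hσ₂ hL] at hx
  exact ((mem_tTilde_iff hσ₁ hσ₂ hL hx₁ hx₂).1 ⟨hx.1, h⟩).2.ne hx.2

/-- Moving away from both centers without widening the angle leaves `M↑` from `T`. -/
lemma notMem_mUp_of_farther (hσ₁ : 0 < σ₁) (hσ₂ : 0 < σ₂) (hL : 0 < L)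
    (hx₁ : x₁ = EuclideanSpace.single 0 (-r)) (hx₂ : x₂ = EuclideanSpace.single 0 r)
    (hx : x ∈ curveT x₁ x₂ σ₁ σ₂ L r) (h₁ : ‖x - x₁‖ < ‖y - x₁‖) (h₂ : ‖x - x₂‖ < ‖y - x₂‖)
    (hcos : (‖x‖ ^ 2 - r ^ 2) / (‖x - x₁‖ * ‖x - x₂‖) ≤
      (‖y‖ ^ 2 - r ^ 2) / (‖y - x₁‖ * ‖y - x₂‖)) :
    y ∉ mUp x₁ x₂ σ₁ σ₂ L := by
  rintro ⟨hyD, hy⟩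
  obtain ⟨hy₁, hy₂, hn₁, -⟩ := mem_angleDom_iff.1 hyD
  have hφ₁ := phiT_lt_phiT hσ₁ hL h₁ hy₁
  have hφ₂ := phiT_lt_phiT hσ₂ hL h₂ hy₂
  have hψ := psi_eq_of_mem_curveT hσ₁ hσ₂ hL hx₁ hx₂ hx
  rw [psi_eq_pi_sub_arccos hx₁ hx₂ hx.1] at hψ
  rw [psi_eq_pi_sub_arccos hx₁ hx₂ hn₁] at hy
  have := Real.arccos_le_arccos hcos
  linarith

/-- An escape path is needed along which both distances grow and the angle does not. If `‖x‖ ≥ r`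
(angle at most `π/2`), dilation from the origin works; if `‖x‖ ≤ r`, moving perpendicularly away
from the axis does. -/
lemma mem_closure_compl_mUp_of_offAxis (hσ₁ : 0 < σ₁) (hσ₂ : 0 < σ₂) (hL : 0 < L) (hr : 0 < r)
    (hx₁ : x₁ = EuclideanSpace.single 0 (-r)) (hx₂ : x₂ = EuclideanSpace.single 0 r)
    (hx : x ∈ curveT x₁ x₂ σ₁ σ₂ L r) (hw : x 0 ^ 2 < ‖x‖ ^ 2) :
    x ∈ closure (mUp x₁ x₂ σ₁ σ₂ L)ᶜ := by
  have hp₁ : 0 < ‖x - x₁‖ := norm_pos_iff.2 (sub_ne_zero.2 hx.1)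
  have hp₂ : 0 < ‖x - x₂‖ := norm_pos_iff.2 (sub_ne_zero.2 hx.2.1)
  have e₁ := sq_dist_left hx₁ x
  have e₂ := sq_dist_right hx₂ x
  rcases le_total (r ^ 2) (‖x‖ ^ 2) with hρ | hρ
  · have hmem : ∀ t : ℝ, t > 0 → (1 + t) • x ∈ (mUp x₁ x₂ σ₁ σ₂ L)ᶜ := by
      intro t ht
      have f₁ := sq_dist_left hx₁ ((1 + t) • x)
      have f₂ := sq_dist_right hx₂ ((1 + t) • x)
      have hnorm : ‖(1 + t) • x‖ ^ 2 = (1 + t) ^ 2 * ‖x‖ ^ 2 := by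
        rw [norm_smul, mul_pow, Real.norm_eq_abs, sq_abs]
      rw [hnorm, PiLp.smul_apply, smul_eq_mul] at f₁ f₂
      -- This keeps the term `± 2rt x₀` in the change of squared distance from outweighing `2t‖x‖²`;
      -- a positive `t²‖x‖²` is left over.
      have hru : |r * x 0| ≤ ‖x‖ ^ 2 := by
        rw [abs_mul, abs_of_pos hr, sq ‖x‖]
        exact mul_le_mul ((sq_le_sq₀ hr.le (norm_nonneg _)).1 hρ)
          (abs_le_of_sq_le_sq hw.le (norm_nonneg _)) (abs_nonneg _) (norm_nonneg _)
      have hru' := abs_le.1 hru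
      have hP : 0 < ‖x‖ ^ 2 := (sq_nonneg _).trans_lt hw
      have l₁ : ‖x - x₁‖ < ‖(1 + t) • x - x₁‖ := by
        refine lt_of_pow_lt_pow_left₀ 2 (norm_nonneg _) ?_
        rw [e₁, f₁]
        nlinarith [mul_pos (mul_pos ht ht) hP]
      have l₂ : ‖x - x₂‖ < ‖(1 + t) • x - x₂‖ := by
        refine lt_of_pow_lt_pow_left₀ 2 (norm_nonneg _) ?_
        rw [e₂, f₂]
        nlinarith [mul_pos (mul_pos ht ht) hP]
      refine notMem_mUp_of_farther hσ₁ hσ₂ hL hx₁ hx₂ hx l₁ l₂ ?_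
      rw [hnorm]
      exact cosine_le_of_scaled (by linarith) hρ hw.le hp₁ hp₂ (hp₁.trans l₁) (hp₂.trans l₂)
        e₁ e₂ f₁ f₂
    simpa using mem_closure_of_curve (f := fun t => (1 + t) • x) (by fun_prop) hmem
  -- The path fixes the first coordinate and multiplies the orthogonal component by `1 + t`. The
  -- numerator of the cosine starts nonpositive and increases, and the denominator grows, so the
  -- quotient increases.
  · have hmem : ∀ t : ℝ, t > 0 →
        (1 + t) • x - (t * x 0) • (EuclideanSpace.single 0 1 : R n) ∈ (mUp x₁ x₂ σ₁ σ₂ L)ᶜ := by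
      intro t ht
      rw [smul_single_one]
      obtain ⟨y, hy⟩ : ∃ y, y = (1 + t) • x - EuclideanSpace.single 0 (t * x 0) := ⟨_, rfl⟩
      rw [← hy]
      have f₁ := sq_dist_left hx₁ y
      have f₂ := sq_dist_right hx₂ y
      have hy0 : y 0 = x 0 := by rw [hy]; simp; ring
      have hnorm : ‖y‖ ^ 2 = ‖x‖ ^ 2 + (2 * t + t ^ 2) * (‖x‖ ^ 2 - x 0 ^ 2) := by
        rw [hy, norm_sub_single_sq, norm_smul, mul_pow, Real.norm_eq_abs, sq_abs,
          PiLp.smul_apply, smul_eq_mul]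
        ring
      have hlt : ‖x‖ ^ 2 < ‖y‖ ^ 2 := by
        rw [hnorm]
        have := mul_pos (show 0 < 2 * t + t ^ 2 by positivity) (sub_pos.2 hw)
        linarith
      rw [hy0] at f₁ f₂
      have l₁ : ‖x - x₁‖ < ‖y - x₁‖ :=
        lt_of_pow_lt_pow_left₀ 2 (norm_nonneg _) (by linarith)
      have l₂ : ‖x - x₂‖ < ‖y - x₂‖ :=
        lt_of_pow_lt_pow_left₀ 2 (norm_nonneg _) (by linarith)
      refine notMem_mUp_of_farther hσ₁ hσ₂ hL hx₁ hx₂ hx l₁ l₂ ?_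
      have q₁ := hp₁.trans l₁
      have q₂ := hp₂.trans l₂
      rw [div_le_div_iff₀ (by positivity) (by positivity)]
      calc (‖x‖ ^ 2 - r ^ 2) * (‖y - x₁‖ * ‖y - x₂‖)
          ≤ (‖x‖ ^ 2 - r ^ 2) * (‖x - x₁‖ * ‖x - x₂‖) :=
            mul_le_mul_of_nonpos_left (by gcongr) (by linarith)
        _ ≤ (‖y‖ ^ 2 - r ^ 2) * (‖x - x₁‖ * ‖x - x₂‖) := by gcongr
    simpa using mem_closure_of_curve (f := fun t =>
      (1 + t) • x - (t * x 0) • (EuclideanSpace.single 0 1 : R n)) (by fun_prop) hmem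

lemma mem_frontier_mUp_of_mem_curveT (hσ₁ : 0 < σ₁) (hσ₂ : 0 < σ₂) (hL : 0 < L) (hr : 0 < r)
    (hx₁ : x₁ = EuclideanSpace.single 0 (-r)) (hx₂ : x₂ = EuclideanSpace.single 0 r)
    (htan : 2 * r < L / σ₁ + L / σ₂) (hx : x ∈ curveT x₁ x₂ σ₁ σ₂ L r) :
    x ∈ frontier (mUp x₁ x₂ σ₁ σ₂ L) := by
  rw [frontier_eq_closure_inter_closure]
  refine ⟨subset_closure (curveT_subset_mUp hσ₁ hσ₂ hL hx₁ hx₂ hx),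
    mem_closure_compl_mUp_of_offAxis hσ₁ hσ₂ hL hr hx₁ hx₂ hx ?_⟩
  obtain ⟨hD, hg⟩ := (mem_curveT_iff hσ₁ hσ₂ hL).1 hx
  obtain ⟨hd₁, hd₂, h₁, h₂⟩ := mem_angleDom_iff.1 hD
  exact offAxis_estimate (div_pos hσ₁ hL) (div_pos hσ₂ hL) hr (norm_pos_iff.2 (sub_ne_zero.2 h₁))
    (norm_pos_iff.2 (sub_ne_zero.2 h₂)) (sq_dist_left hx₁ x) (sq_dist_right hx₂ x) (coord_sq_le x)
    ((scaled_le_one_iff hσ₁ hL).2 hd₁) ((scaled_le_one_iff hσ₂ hL).2 hd₂)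
    (by simpa using htan) hg

end

/-! ### Spheres, caps, closure and interior -/

section

variable {n : ℕ} {σ₁ σ₂ L r : ℝ} {x₁ x₂ x : R n}

lemma sphere_gap_identity {s t r u P d e B : ℝ} (hsd : s * d = 1)
    (hdP : d ^ 2 = P + 2 * r * u + r ^ 2) (heP : e ^ 2 = P - 2 * r * u + r ^ 2) :
    s ^ 3 * (P - r ^ 2 + d * e * (s * d * (t * e) - √(1 - (s * d) ^ 2) * B)) =
      s + t - 2 * r ^ 2 * s ^ 3 - 2 * r * s ^ 2 * (s + 2 * t) * u := by
  have he : e ^ 2 = d ^ 2 - 4 * r * u := by linarith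
  have hP : P = d ^ 2 - 2 * r * u - r ^ 2 := by linarith
  have h2 : s ^ 2 * d ^ 2 = 1 := by rw [← mul_pow, hsd, one_pow]
  rw [hsd, one_pow, sub_self, Real.sqrt_zero, hP]
  have : s ^ 3 * (d ^ 2 - 2 * r * u - r ^ 2 - r ^ 2 + d * e * (1 * (t * e) - 0 * B)) =
      s * (s ^ 2 * d ^ 2) - s ^ 3 * (2 * r * u + 2 * r ^ 2) + s ^ 2 * (s * d) * t * e ^ 2 := by
    ring
  rw [this, he, hsd, h2]
  linear_combination t * h2

/-- On the sphere the square-root product drops out, and what `gap` adds to `‖x‖² - r²` is positive.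
-/
lemma sq_norm_lt_of_gap_nonpos_of_left_sphere (hσ₁ : 0 < σ₁) (hσ₂ : 0 < σ₂) (hL : 0 < L)
    (hx₂ : x ≠ x₂) (hd : ‖x - x₁‖ = L / σ₁) (hg : gap x₁ x₂ σ₁ σ₂ L r x ≤ 0) :
    ‖x‖ ^ 2 < r ^ 2 := by
  have hp₁ : 0 < ‖x - x₁‖ := by rw [hd]; positivity
  have hp₂ : 0 < ‖x - x₂‖ := norm_pos_iff.2 (sub_ne_zero.2 hx₂)
  have hsd : σ₁ / L * ‖x - x₁‖ = 1 := by rw [hd]; field_simp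
  have : 0 < ‖x - x₁‖ * ‖x - x₂‖ * (σ₂ / L * ‖x - x₂‖) := by positivity
  simp only [gap, hsd] at hg
  simp at hg
  linarith

lemma sq_norm_lt_of_gap_nonpos_of_right_sphere (hσ₁ : 0 < σ₁) (hσ₂ : 0 < σ₂) (hL : 0 < L)
    (hx₁ : x ≠ x₁) (hd : ‖x - x₂‖ = L / σ₂) (hg : gap x₁ x₂ σ₁ σ₂ L r x ≤ 0) :
    ‖x‖ ^ 2 < r ^ 2 := by
  have hp₂ : 0 < ‖x - x₂‖ := by rw [hd]; positivity
  have hp₁ : 0 < ‖x - x₁‖ := norm_pos_iff.2 (sub_ne_zero.2 hx₁)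
  have hsd : σ₂ / L * ‖x - x₂‖ = 1 := by rw [hd]; field_simp
  have : 0 < ‖x - x₁‖ * ‖x - x₂‖ * (σ₁ / L * ‖x - x₁‖) := by positivity
  simp only [gap, hsd] at hg
  simp at hg
  linarith

lemma dist_center_lt (hr : 0 < r) {xi : R n} (hxi : ‖xi‖ ≤ r) (hx : ‖x‖ ^ 2 < r ^ 2) :
    ‖x - xi‖ < 2 * r := by
  have := norm_sub_le x xi
  have := lt_of_pow_lt_pow_left₀ 2 hr.le hx
  linarith

lemma isClosed_gap_nonpos (x₁ x₂ : R n) (σ₁ σ₂ L r : ℝ) :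
    IsClosed {x | ‖x - x₁‖ ≤ L / σ₁ ∧ ‖x - x₂‖ ≤ L / σ₂ ∧ gap x₁ x₂ σ₁ σ₂ L r x ≤ 0} :=
  (isClosed_le (f := fun x => ‖x - x₁‖) (by fun_prop) continuous_const).inter
    ((isClosed_le (f := fun x => ‖x - x₂‖) (by fun_prop) continuous_const).inter
      (isClosed_le (continuous_gap x₁ x₂ σ₁ σ₂ L r) continuous_const))

variable [NeZero n]

lemma norm_foci_sub (hr : 0 < r) (hx₁ : x₁ = EuclideanSpace.single 0 (-r))
    (hx₂ : x₂ = EuclideanSpace.single 0 r) : ‖x₁ - x₂‖ = 2 * r := by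
  have h := sq_dist_right hx₂ x₁
  have h₁ : ‖x₁‖ ^ 2 = r ^ 2 := by rw [hx₁]; simp
  have h₂ : x₁ 0 = -r := by rw [hx₁]; simp
  rw [h₁, h₂] at h
  exact (pow_left_inj₀ (norm_nonneg _) (by positivity) two_ne_zero).1 (by rw [h]; ring)

lemma gap_left_center (hx₁ : x₁ = EuclideanSpace.single 0 (-r)) :
    gap x₁ x₂ σ₁ σ₂ L r x₁ = 0 := by
  have h₁ : ‖x₁‖ ^ 2 = r ^ 2 := by rw [hx₁]; simp
  simp [gap, h₁]

lemma gap_right_center (hx₂ : x₂ = EuclideanSpace.single 0 r) :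
    gap x₁ x₂ σ₁ σ₂ L r x₂ = 0 := by
  have h₁ : ‖x₂‖ ^ 2 = r ^ 2 := by rw [hx₂]; simp
  simp [gap, h₁]

lemma gap_neg_iff_of_mem_left_sphere (hσ₁ : 0 < σ₁) (hσ₂ : 0 < σ₂) (hL : 0 < L) (hr : 0 < r)
    (hx₁ : x₁ = EuclideanSpace.single 0 (-r)) (hx₂ : x₂ = EuclideanSpace.single 0 r)
    (hd : ‖x - x₁‖ = L / σ₁) : gap x₁ x₂ σ₁ σ₂ L r x < 0 ↔ lam₁ σ₁ σ₂ L r < x 0 := by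
  have hsd : σ₁ / L * ‖x - x₁‖ = 1 := by rw [hd]; field_simp
  have h := sphere_gap_identity (t := σ₂ / L) (B := √(1 - (σ₂ / L * ‖x - x₂‖) ^ 2)) hsd
    (sq_dist_left hx₁ x) (sq_dist_right hx₂ x)
  rw [lam₁_lt_iff hσ₁ hσ₂ hL hr, ← sub_neg (b := 2 * r * _ * _ * _), ← h]
  have hp : 0 < (σ₁ / L) ^ 3 := by positivity
  exact ⟨mul_neg_of_pos_of_neg hp, fun h => not_le.1 fun h' => h.not_ge (mul_nonneg hp.le h')⟩

lemma gap_neg_iff_of_mem_right_sphere (hσ₁ : 0 < σ₁) (hσ₂ : 0 < σ₂) (hL : 0 < L) (hr : 0 < r)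
    (hx₁ : x₁ = EuclideanSpace.single 0 (-r)) (hx₂ : x₂ = EuclideanSpace.single 0 r)
    (hd : ‖x - x₂‖ = L / σ₂) : gap x₁ x₂ σ₁ σ₂ L r x < 0 ↔ x 0 < lam₂ σ₁ σ₂ L r := by
  have hsd : σ₂ / L * ‖x - x₂‖ = 1 := by rw [hd]; field_simp
  have h := sphere_gap_identity (t := σ₁ / L) (u := -x 0) (r := r) (P := ‖x‖ ^ 2)
    (e := ‖x - x₁‖) (B := √(1 - (σ₁ / L * ‖x - x₁‖) ^ 2)) hsd
    (by rw [sq_dist_right hx₂]; ring) (by rw [sq_dist_left hx₁]; ring)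
  rw [lam₂_eq_neg_lam₁ hσ₁ hσ₂, lt_neg, lam₁_lt_iff hσ₂ hσ₁ hL hr,
    ← sub_neg (b := 2 * r * _ * _ * _), ← h]
  have e : gap x₁ x₂ σ₁ σ₂ L r x = ‖x‖ ^ 2 - r ^ 2 + ‖x - x₂‖ * ‖x - x₁‖ *
      (σ₂ / L * ‖x - x₂‖ * (σ₁ / L * ‖x - x₁‖) -
        √(1 - (σ₂ / L * ‖x - x₂‖) ^ 2) * √(1 - (σ₁ / L * ‖x - x₁‖) ^ 2)) := by
    unfold gap; ring
  rw [e]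
  have hp : 0 < (σ₂ / L) ^ 3 := by positivity
  exact ⟨mul_neg_of_pos_of_neg hp, fun h => not_le.1 fun h' => h.not_ge (mul_nonneg hp.le h')⟩

lemma left_cap (hσ₁ : 0 < σ₁) (hσ₂ : 0 < σ₂) (hL : 0 < L) (hr : 0 < r)
    (hx₁ : x₁ = EuclideanSpace.single 0 (-r)) (hx₂ : x₂ = EuclideanSpace.single 0 r)
    (hd : ‖x - x₁‖ ≤ L / σ₁) (hu : lam₁ σ₁ σ₂ L r < x 0) :
    ‖x - x₂‖ < L / σ₂ ∧ gap x₁ x₂ σ₁ σ₂ L r x < 0 := by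
  obtain ⟨h₁, h₂⟩ := cap_estimate (div_pos hσ₁ hL) (div_pos hσ₂ hL) hr (norm_nonneg _)
    (sq_dist_left hx₁ x) (sq_dist_right hx₂ x) (coord_sq_le x) ((scaled_le_one_iff hσ₁ hL).2 hd)
    ((lam₁_lt_iff hσ₁ hσ₂ hL hr).1 hu)
  refine ⟨by rwa [div_mul_eq_mul_div, div_lt_one hL, mul_comm, ← lt_div_iff₀ hσ₂] at h₁, ?_⟩
  -- This term enters `gap` with a minus sign, so the estimate without it suffices.
  have : 0 ≤ ‖x - x₁‖ * ‖x - x₂‖ *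
    (√(1 - (σ₁ / L * ‖x - x₁‖) ^ 2) * √(1 - (σ₂ / L * ‖x - x₂‖) ^ 2)) := by positivity
  unfold gap
  linarith

lemma right_cap (hσ₁ : 0 < σ₁) (hσ₂ : 0 < σ₂) (hL : 0 < L) (hr : 0 < r)
    (hx₁ : x₁ = EuclideanSpace.single 0 (-r)) (hx₂ : x₂ = EuclideanSpace.single 0 r)
    (hd : ‖x - x₂‖ ≤ L / σ₂) (hu : x 0 < lam₂ σ₁ σ₂ L r) :
    ‖x - x₁‖ < L / σ₁ ∧ gap x₁ x₂ σ₁ σ₂ L r x < 0 := by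
  rw [lam₂_eq_neg_lam₁ hσ₁ hσ₂, lt_neg] at hu
  obtain ⟨h₁, h₂⟩ := cap_estimate (u := -x 0) (P := ‖x‖ ^ 2) (e := ‖x - x₁‖)
    (div_pos hσ₂ hL) (div_pos hσ₁ hL) hr (norm_nonneg _)
    (by rw [sq_dist_right hx₂]; ring) (by rw [sq_dist_left hx₁]; ring)
    (by rw [neg_sq]; exact coord_sq_le x) ((scaled_le_one_iff hσ₂ hL).2 hd)
    ((lam₁_lt_iff hσ₂ hσ₁ hL hr).1 hu)
  refine ⟨by rwa [div_mul_eq_mul_div, div_lt_one hL, mul_comm, ← lt_div_iff₀ hσ₁] at h₁, ?_⟩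
  have : 0 ≤ ‖x - x₁‖ * ‖x - x₂‖ *
    (√(1 - (σ₁ / L * ‖x - x₁‖) ^ 2) * √(1 - (σ₂ / L * ‖x - x₂‖) ^ 2)) := by positivity
  unfold gap
  linarith

lemma coord_mem_Icc (hx₁ : x₁ = EuclideanSpace.single 0 (-r)) (hx₂ : x₂ = EuclideanSpace.single 0 r)
    (hd₁ : ‖x - x₁‖ ≤ L / σ₁) (hd₂ : ‖x - x₂‖ ≤ L / σ₂) :
    x 0 ∈ Set.Icc (r - L / σ₂) (L / σ₁ - r) := by
  have hP := coord_sq_le x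
  have h₁ : x 0 + r ≤ ‖x - x₁‖ := le_of_abs_le (abs_le_of_sq_le_sq
    (by rw [sq_dist_left hx₁]; linarith) (norm_nonneg _))
  have h₂ : r - x 0 ≤ ‖x - x₂‖ := le_of_abs_le (abs_le_of_sq_le_sq
    (by rw [sq_dist_right hx₂]; linarith) (norm_nonneg _))
  constructor <;> linarith

/-- The abscissa `λ₂` does not exceed `λ₁` as long as the balls meet. -/
lemma lam₂_le_lam₁ (hσ₁ : 0 < σ₁) (hσ₂ : 0 < σ₂) (hL : 0 < L) (hr : 0 < r)
    (htan : 2 * r ≤ L / σ₁ + L / σ₂) : lam₂ σ₁ σ₂ L r ≤ lam₁ σ₁ σ₂ L r := by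
  obtain ⟨a, ha⟩ : ∃ a, a = L / σ₁ := ⟨_, rfl⟩
  obtain ⟨b, hb⟩ : ∃ b, b = L / σ₂ := ⟨_, rfl⟩
  have ha0 : 0 < a := by rw [ha]; positivity
  have hb0 : 0 < b := by rw [hb]; positivity
  rw [← ha, ← hb] at htan
  have e₁ : lam₁ σ₁ σ₂ L r = ((a + b) * a ^ 2 / (2 * r) - r * b) / (2 * a + b) := by
    unfold lam₁ bet gam
    rw [ha, hb]
    have : 2 * σ₂ + σ₁ ≠ 0 := by positivity
    have : σ₁ + 2 * σ₂ ≠ 0 := by positivity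
    field_simp
    ring
  have e₂ : lam₂ σ₁ σ₂ L r = -(((a + b) * b ^ 2 / (2 * r) - r * a) / (a + 2 * b)) := by
    unfold lam₂ bet gam
    rw [ha, hb]
    have : 2 * σ₁ + σ₂ ≠ 0 := by positivity
    have : σ₂ + 2 * σ₁ ≠ 0 := by positivity
    field_simp
    ring
  -- `(a - b) / 2` separates the two abscissas; it is their common value when the spheres are
  -- tangent, `2r = a + b`.
  have h₁ : (a - b) / 2 ≤ lam₁ σ₁ σ₂ L r := by
    rw [e₁, le_div_iff₀ (by positivity)]
    have h : a ^ 2 ≤ (a + b) * a ^ 2 / (2 * r) := by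
      rw [le_div_iff₀ (by positivity)]; nlinarith [sq_nonneg a]
    nlinarith
  have h₂ : lam₂ σ₁ σ₂ L r ≤ (a - b) / 2 := by
    have h : b ^ 2 ≤ (a + b) * b ^ 2 / (2 * r) := by
      rw [le_div_iff₀ (by positivity)]; nlinarith [sq_nonneg b]
    have : (b - a) / 2 ≤ ((a + b) * b ^ 2 / (2 * r) - r * a) / (a + 2 * b) := by
      rw [le_div_iff₀ (by positivity)]
      nlinarith
    rw [e₂]
    linarith
  exact h₂.trans h₁

/-- If the second center lies in the closed first ball, `M↑` does not meet the first sphere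
except possibly at that center. -/
lemma ne_left_radius (hσ₁ : 0 < σ₁) (hσ₂ : 0 < σ₂) (hL : 0 < L) (hr : 0 < r)
    (hx₁ : x₁ = EuclideanSpace.single 0 (-r)) (hra : 2 * r ≤ L / σ₁) (h₂ : x ≠ x₂)
    (hg : gap x₁ x₂ σ₁ σ₂ L r x ≤ 0) : ‖x - x₁‖ ≠ L / σ₁ := fun hd =>
  (dist_center_lt (xi := x₁) hr (by rw [hx₁]; simp [abs_of_pos hr])
    (sq_norm_lt_of_gap_nonpos_of_left_sphere hσ₁ hσ₂ hL h₂ hd hg)).not_ge (by rw [hd]; exact hra)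

lemma ne_right_radius (hσ₁ : 0 < σ₁) (hσ₂ : 0 < σ₂) (hL : 0 < L) (hr : 0 < r)
    (hx₂ : x₂ = EuclideanSpace.single 0 r) (hra : 2 * r ≤ L / σ₂) (h₁ : x ≠ x₁)
    (hg : gap x₁ x₂ σ₁ σ₂ L r x ≤ 0) : ‖x - x₂‖ ≠ L / σ₂ := fun hd =>
  (dist_center_lt (xi := x₂) hr (by rw [hx₂]; simp [abs_of_pos hr])
    (sq_norm_lt_of_gap_nonpos_of_right_sphere hσ₁ hσ₂ hL h₁ hd hg)).not_ge (by rw [hd]; exact hra)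

/-- Between the centers the segment is seen under the angle `π`, so `ψ = 0` and only the ball
conditions remain. -/
lemma single_mem_mUp (hσ₁ : 0 < σ₁) (hσ₂ : 0 < σ₂) (hL : 0 < L)
    (hx₁ : x₁ = EuclideanSpace.single 0 (-r)) (hx₂ : x₂ = EuclideanSpace.single 0 r) {c : ℝ}
    (hc₁ : -r < c) (hc₂ : c < r) (hca : r + c ≤ L / σ₁) (hcb : r - c ≤ L / σ₂) :
    (EuclideanSpace.single 0 c : R n) ∈ mUp x₁ x₂ σ₁ σ₂ L := by
  obtain ⟨x, hx⟩ : ∃ x, x = (EuclideanSpace.single 0 c : R n) := ⟨_, rfl⟩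
  have hx0 : x 0 = c := by rw [hx]; simp
  have hxn : ‖x‖ ^ 2 = c ^ 2 := by rw [hx]; simp
  have h₁ : ‖x - x₁‖ = r + c := (pow_left_inj₀ (norm_nonneg _) (by linarith) two_ne_zero).1
    (by rw [sq_dist_left hx₁, hx0, hxn]; ring)
  have h₂ : ‖x - x₂‖ = r - c := (pow_left_inj₀ (norm_nonneg _) (by linarith) two_ne_zero).1
    (by rw [sq_dist_right hx₂, hx0, hxn]; ring)
  have n₁ : x ≠ x₁ := fun h => by rw [h, sub_self, norm_zero] at h₁; linarith
  have n₂ : x ≠ x₂ := fun h => by rw [h, sub_self, norm_zero] at h₂; linarith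
  rw [← hx]
  refine ⟨mem_angleDom_iff.2 ⟨h₁ ▸ hca, h₂ ▸ hcb, n₁, n₂⟩, ?_⟩
  have hne : (r + c) * (r - c) ≠ 0 := mul_ne_zero (by linarith) (by linarith)
  have : (c ^ 2 - r ^ 2) / ((r + c) * (r - c)) = -1 := by rw [div_eq_iff hne]; ring
  rw [psi_eq_pi_sub_arccos hx₁ hx₂ n₁, h₁, h₂, hxn, this, Real.arccos_neg_one, sub_self]
  exact (phiT_add_mem_Icc hσ₁ hσ₂ hL).1

lemma continuous_single : Continuous fun c : ℝ => (EuclideanSpace.single 0 c : R n) := by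
  have : (fun c : ℝ => (EuclideanSpace.single 0 c : R n)) =
      fun c => c • (EuclideanSpace.single 0 1 : R n) := by
    funext c; rw [smul_single_one]
  rw [this]
  fun_prop

lemma left_center_mem_closure (hσ₁ : 0 < σ₁) (hσ₂ : 0 < σ₂) (hL : 0 < L) (hr : 0 < r)
    (hx₁ : x₁ = EuclideanSpace.single 0 (-r)) (hx₂ : x₂ = EuclideanSpace.single 0 r)
    (hrb : 2 * r ≤ L / σ₂) : x₁ ∈ closure (mUp x₁ x₂ σ₁ σ₂ L) := by
  have hc := continuous_single (n := n)
  have ha : 0 < L / σ₁ := by positivity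
  -- Abscissas in this interval lie between the centers and inside the first ball; the second ball
  -- imposes nothing because `2r ≤ L/σ₂`.
  have hlt : -r < min r (L / σ₁ - r) := lt_min (by linarith) (by linarith)
  rw [show x₁ ∈ closure (mUp x₁ x₂ σ₁ σ₂ L) ↔ EuclideanSpace.single 0 (-r) ∈
    closure (mUp x₁ x₂ σ₁ σ₂ L) by rw [← hx₁]]
  refine map_mem_closure (s := Set.Ioo (-r) (min r (L / σ₁ - r))) hc ?_ ?_
  · rw [closure_Ioo hlt.ne]; exact Set.left_mem_Icc.2 hlt.le
  · rintro c ⟨hc, hc'⟩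
    obtain ⟨h, h'⟩ := lt_min_iff.1 hc'
    exact single_mem_mUp hσ₁ hσ₂ hL hx₁ hx₂ hc h (by linarith) (by linarith)

lemma right_center_mem_closure (hσ₁ : 0 < σ₁) (hσ₂ : 0 < σ₂) (hL : 0 < L) (hr : 0 < r)
    (hx₁ : x₁ = EuclideanSpace.single 0 (-r)) (hx₂ : x₂ = EuclideanSpace.single 0 r)
    (hra : 2 * r ≤ L / σ₁) : x₂ ∈ closure (mUp x₁ x₂ σ₁ σ₂ L) := by
  have hc := continuous_single (n := n)
  have ha : 0 < L / σ₂ := by positivity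
  have hlt : max (-r) (r - L / σ₂) < r := max_lt (by linarith) (by linarith)
  rw [show x₂ ∈ closure (mUp x₁ x₂ σ₁ σ₂ L) ↔ EuclideanSpace.single 0 r ∈
    closure (mUp x₁ x₂ σ₁ σ₂ L) by rw [← hx₂]]
  refine map_mem_closure (s := Set.Ioo (max (-r) (r - L / σ₂)) r) hc ?_ ?_
  · rw [closure_Ioo hlt.ne]; exact Set.right_mem_Icc.2 hlt.le
  · rintro c ⟨hc, hc'⟩
    obtain ⟨h, h'⟩ := max_lt_iff.1 hc
    exact single_mem_mUp hσ₁ hσ₂ hL hx₁ hx₂ h hc' (by linarith) (by linarith)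

/-- The right side is closed and differs from `M↑` at most by the centers. A center lying in the
other closed ball is a limit of points of the segment. -/
lemma mem_closure_mUp_iff (hσ₁ : 0 < σ₁) (hσ₂ : 0 < σ₂) (hL : 0 < L) (hr : 0 < r)
    (hx₁ : x₁ = EuclideanSpace.single 0 (-r)) (hx₂ : x₂ = EuclideanSpace.single 0 r) :
    x ∈ closure (mUp x₁ x₂ σ₁ σ₂ L) ↔
      ‖x - x₁‖ ≤ L / σ₁ ∧ ‖x - x₂‖ ≤ L / σ₂ ∧ gap x₁ x₂ σ₁ σ₂ L r x ≤ 0 := by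
  constructor
  · intro h
    refine (closure_minimal ?_ (isClosed_gap_nonpos x₁ x₂ σ₁ σ₂ L r)) h
    intro y hy
    obtain ⟨hD, hg⟩ := (mem_mUp_iff hσ₁ hσ₂ hL hx₁ hx₂).1 hy
    obtain ⟨h₁, h₂, -, -⟩ := mem_angleDom_iff.1 hD
    exact ⟨h₁, h₂, hg⟩
  · rintro ⟨h₁, h₂, hg⟩
    have hf := norm_foci_sub hr hx₁ hx₂
    by_cases n₁ : x = x₁
    · rw [n₁, hf] at h₂
      rw [n₁]
      exact left_center_mem_closure hσ₁ hσ₂ hL hr hx₁ hx₂ h₂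
    by_cases n₂ : x = x₂
    · rw [n₂, norm_sub_rev, hf] at h₁
      rw [n₂]
      exact right_center_mem_closure hσ₁ hσ₂ hL hr hx₁ hx₂ h₁
    exact subset_closure ((mem_mUp_iff hσ₁ hσ₂ hL hx₁ hx₂).2
      ⟨mem_angleDom_iff.2 ⟨h₁, h₂, n₁, n₂⟩, hg⟩)

/-- An interior point with `gap = 0` would lie on `T`, hence on the frontier. Conversely the strict
conditions are open, and `gap < 0` already excludes the centers. -/
lemma mem_interior_mUp_iff (hσ₁ : 0 < σ₁) (hσ₂ : 0 < σ₂) (hL : 0 < L) (hr : 0 < r)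
    (hx₁ : x₁ = EuclideanSpace.single 0 (-r)) (hx₂ : x₂ = EuclideanSpace.single 0 r)
    (htan : 2 * r < L / σ₁ + L / σ₂) :
    x ∈ interior (mUp x₁ x₂ σ₁ σ₂ L) ↔
      ‖x - x₁‖ < L / σ₁ ∧ ‖x - x₂‖ < L / σ₂ ∧ gap x₁ x₂ σ₁ σ₂ L r x < 0 := by
  constructor
  · intro h
    have ball : ∀ (xi : R n) (ρ : ℝ), 0 < ρ →
        (∀ y ∈ mUp x₁ x₂ σ₁ σ₂ L, ‖y - xi‖ ≤ ρ) → ‖x - xi‖ < ρ := by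
      intro xi ρ hρ hsub
      have h' : x ∈ interior (Metric.closedBall xi ρ) :=
        interior_mono (fun y hy => mem_closedBall_iff_norm.2 (hsub y hy)) h
      rw [interior_closedBall _ hρ.ne'] at h'
      exact mem_ball_iff_norm.1 h'
    refine ⟨ball x₁ _ (by positivity) fun y hy => (mem_angleDom_iff.1 hy.1).1,
      ball x₂ _ (by positivity) fun y hy => (mem_angleDom_iff.1 hy.1).2.1, ?_⟩
    obtain ⟨hD, hg⟩ := (mem_mUp_iff hσ₁ hσ₂ hL hx₁ hx₂).1 (interior_subset h)
    refine lt_of_le_of_ne hg fun h0 => ?_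
    exact (mem_frontier_mUp_of_mem_curveT hσ₁ hσ₂ hL hr hx₁ hx₂ htan
      ((mem_curveT_iff hσ₁ hσ₂ hL).2 ⟨hD, h0⟩)).2 h
  · intro h
    have ho : IsOpen {x | ‖x - x₁‖ < L / σ₁ ∧ ‖x - x₂‖ < L / σ₂ ∧ gap x₁ x₂ σ₁ σ₂ L r x < 0} :=
      (isOpen_lt (f := fun x => ‖x - x₁‖) (by fun_prop) continuous_const).inter
        ((isOpen_lt (f := fun x => ‖x - x₂‖) (by fun_prop) continuous_const).inter
          (isOpen_lt (continuous_gap x₁ x₂ σ₁ σ₂ L r) continuous_const))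
    refine interior_maximal ?_ ho h
    rintro y ⟨h₁, h₂, hg⟩
    refine (mem_mUp_iff hσ₁ hσ₂ hL hx₁ hx₂).2
      ⟨mem_angleDom_iff.2 ⟨h₁.le, h₂.le, ?_, ?_⟩, hg.le⟩
    · rintro rfl; exact hg.ne (gap_left_center hx₁)
    · rintro rfl; exact hg.ne (gap_right_center hx₂)

end

/-! ### The frontier, the degenerate radii and the five cases -/

section

variable {n : ℕ} [NeZero n] {σ₁ σ₂ L r : ℝ} {x₁ x₂ x : R n}

lemma mem_frontier_mUp_iff (hσ₁ : 0 < σ₁) (hσ₂ : 0 < σ₂) (hL : 0 < L) (hr : 0 < r)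
    (hx₁ : x₁ = EuclideanSpace.single 0 (-r)) (hx₂ : x₂ = EuclideanSpace.single 0 r)
    (htan : 2 * r < L / σ₁ + L / σ₂) :
    x ∈ frontier (mUp x₁ x₂ σ₁ σ₂ L) ↔
      (‖x - x₁‖ ≤ L / σ₁ ∧ ‖x - x₂‖ ≤ L / σ₂ ∧ gap x₁ x₂ σ₁ σ₂ L r x ≤ 0) ∧
      (‖x - x₁‖ = L / σ₁ ∨ ‖x - x₂‖ = L / σ₂ ∨ gap x₁ x₂ σ₁ σ₂ L r x = 0) := by
  rw [frontier, Set.mem_sdiff, mem_closure_mUp_iff hσ₁ hσ₂ hL hr hx₁ hx₂,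
    mem_interior_mUp_iff hσ₁ hσ₂ hL hr hx₁ hx₂ htan]
  refine and_congr_right fun ⟨h₁, h₂, h₃⟩ => ?_
  rw [h₁.lt_iff_ne, h₂.lt_iff_ne, h₃.lt_iff_ne]
  tauto

lemma mUp_eq_singleton (hσ₁ : 0 < σ₁) (hσ₂ : 0 < σ₂) (hL : 0 < L)
    (hx₁ : x₁ = EuclideanSpace.single 0 (-r)) (hx₂ : x₂ = EuclideanSpace.single 0 r)
    (htan : 2 * r = L / σ₁ + L / σ₂) :
    mUp x₁ x₂ σ₁ σ₂ L = {EuclideanSpace.single 0 ((L / σ₁ - L / σ₂) / 2)} := by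
  have ha : 0 < L / σ₁ := by positivity
  have hb : 0 < L / σ₂ := by positivity
  refine Set.eq_singleton_iff_unique_mem.2 ⟨single_mem_mUp hσ₁ hσ₂ hL hx₁ hx₂ (by linarith)
    (by linarith) (by linarith) (by linarith), fun x hx => ?_⟩
  obtain ⟨h₁, h₂, -, -⟩ := mem_angleDom_iff.1 hx.1
  have e₁ := pow_le_pow_left₀ (norm_nonneg _) h₁ 2
  have e₂ := pow_le_pow_left₀ (norm_nonneg _) h₂ 2
  rw [sq_dist_left hx₁] at e₁
  rw [sq_dist_right hx₂] at e₂
  rw [← sub_eq_zero, ← norm_eq_zero, ← sq_eq_zero_iff]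
  refine le_antisymm ?_ (sq_nonneg _)
  rw [norm_sub_single_sq]
  generalize L / σ₁ = a at *
  generalize L / σ₂ = b at *
  have hr' : r = (a + b) / 2 := by linarith
  -- Stewart's identity: with `p` the tangency point, `b d₁² + a d₂² = (a + b)‖x - p‖² + ab(a + b)`,
  -- while the ball conditions bound the left side by `ab(a + b)`.
  have h := add_le_add (mul_le_mul_of_nonneg_left e₁ hb.le) (mul_le_mul_of_nonneg_left e₂ ha.le)
  have h' : (a + b) * (‖x‖ ^ 2 - 2 * ((a - b) / 2) * x 0 + ((a - b) / 2) ^ 2) ≤ (a + b) * 0 := by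
    rw [hr'] at h
    linarith
  exact le_of_mul_le_mul_left h' (by linarith)

lemma mUp_eq_empty (hx₁ : x₁ = EuclideanSpace.single 0 (-r)) (hx₂ : x₂ = EuclideanSpace.single 0 r)
    (htan : L / σ₁ + L / σ₂ < 2 * r) : mUp x₁ x₂ σ₁ σ₂ L = ∅ := by
  refine Set.eq_empty_of_forall_notMem fun x hx => ?_
  obtain ⟨h₁, h₂, -, -⟩ := mem_angleDom_iff.1 hx.1
  obtain ⟨h₃, h₄⟩ := coord_mem_Icc hx₁ hx₂ h₁ h₂
  linarith

end

end SumMinimizer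

theorem mainTheorem2 (n : ℕ) [NeZero n] (σ₁ σ₂ L r : ℝ)
    (hσ₂ : 0 < σ₂) (hσ : σ₂ ≤ σ₁) (hL : 0 < L) (hr : 0 < r)
    (x₁ x₂ : R n)
    (hx₁ : x₁ = EuclideanSpace.single 0 (-r)) (hx₂ : x₂ = EuclideanSpace.single 0 r)
    (M T T' B₁ B₂ H₁m H₂p : Set (R n))
    (hM : M = mUp x₁ x₂ σ₁ σ₂ L)
    (hT : T = curveT x₁ x₂ σ₁ σ₂ L r)
    (hT' : T' = tTilde x₁ x₂ σ₁ σ₂ L)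
    (hB₁ : B₁ = ballB x₁ σ₁ L) (hB₂ : B₂ = ballB x₂ σ₂ L)
    (hH₁m : H₁m = hMinus (lam₁ σ₁ σ₂ L r)) (hH₂p : H₂p = hPlus (lam₂ σ₁ σ₂ L r)) :
    (r ≤ L / (2 * σ₁) →
      (Disjoint M {x₁, x₂} ∧ IsClosed (M ∪ {x₁, x₂})) ∧
      (Disjoint T {x₁, x₂} ∧ frontier M = T ∪ {x₁, x₂}) ∧
      interior M = T') ∧
    (L / (2 * σ₁) < r → r ≤ L / (2 * σ₂) →
      (Disjoint M {x₁} ∧ IsClosed (M ∪ {x₁})) ∧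
      (Disjoint (frontier B₁ ∩ H₁mᶜ) T ∧ Disjoint ((frontier B₁ ∩ H₁mᶜ) ∪ T) {x₁} ∧
        frontier M = (frontier B₁ ∩ H₁mᶜ) ∪ T ∪ {x₁}) ∧
      (Disjoint (B₁ ∩ H₁mᶜ) (T' ∩ H₁m) ∧
        interior M = (B₁ ∩ H₁mᶜ) ∪ (T' ∩ H₁m))) ∧
    (L / (2 * σ₂) < r → r < L / 2 * (1 / σ₁ + 1 / σ₂) →
      IsClosed M ∧
      (Disjoint (frontier B₁ ∩ H₁mᶜ) (frontier B₂ ∩ H₂pᶜ) ∧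
        Disjoint ((frontier B₁ ∩ H₁mᶜ) ∪ (frontier B₂ ∩ H₂pᶜ)) T ∧
        frontier M = (frontier B₁ ∩ H₁mᶜ) ∪ (frontier B₂ ∩ H₂pᶜ) ∪ T) ∧
      (Disjoint (B₁ ∩ H₁mᶜ) (B₂ ∩ H₂pᶜ) ∧
        Disjoint ((B₁ ∩ H₁mᶜ) ∪ (B₂ ∩ H₂pᶜ)) (T' ∩ (H₁m ∩ H₂p)) ∧
        interior M = (B₁ ∩ H₁mᶜ) ∪ (B₂ ∩ H₂pᶜ) ∪ (T' ∩ (H₁m ∩ H₂p)))) ∧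
    (r = L / 2 * (1 / σ₁ + 1 / σ₂) →
      M = {EuclideanSpace.single 0 (L / 2 * (1 / σ₁ - 1 / σ₂))}) ∧
    (L / 2 * (1 / σ₁ + 1 / σ₂) < r → M = ∅) := by
  have hσ₁ : 0 < σ₁ := hσ₂.trans_le hσ
  have ha : 0 < L / σ₁ := by positivity
  have hb : 0 < L / σ₂ := by positivity
  have hab : L / σ₁ ≤ L / σ₂ := div_le_div_of_nonneg_left hL.le hσ₂ hσ
  have ra : L / (2 * σ₁) = L / σ₁ / 2 := by rw [mul_comm, div_mul_eq_div_div]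
  have rb : L / (2 * σ₂) = L / σ₂ / 2 := by rw [mul_comm, div_mul_eq_div_div]
  have rab : L / 2 * (1 / σ₁ + 1 / σ₂) = (L / σ₁ + L / σ₂) / 2 := by ring
  have rab' : L / 2 * (1 / σ₁ - 1 / σ₂) = (L / σ₁ - L / σ₂) / 2 := by ring
  have mF : ∀ x, x ∈ frontier B₁ ↔ ‖x - x₁‖ = L / σ₁ := fun x => by
    rw [hB₁, ballB, frontier_ball _ ha.ne', mem_sphere_iff_norm]
  have mF' : ∀ x, x ∈ frontier B₂ ↔ ‖x - x₂‖ = L / σ₂ := fun x => by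
    rw [hB₂, ballB, frontier_ball _ hb.ne', mem_sphere_iff_norm]
  have mB : ∀ x, x ∈ B₁ ↔ ‖x - x₁‖ < L / σ₁ := fun x => by
    rw [hB₁, ballB, mem_ball_iff_norm]
  have mB' : ∀ x, x ∈ B₂ ↔ ‖x - x₂‖ < L / σ₂ := fun x => by
    rw [hB₂, ballB, mem_ball_iff_norm]
  have mH : ∀ x, x ∈ H₁m ↔ x 0 ≤ lam₁ σ₁ σ₂ L r := fun x => by rw [hH₁m]; rfl
  have mH' : ∀ x, x ∈ H₂p ↔ lam₂ σ₁ σ₂ L r ≤ x 0 := fun x => by rw [hH₂p]; rfl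
  have mM : ∀ x, x ∈ M ↔ (‖x - x₁‖ ≤ L / σ₁ ∧ ‖x - x₂‖ ≤ L / σ₂ ∧ x ≠ x₁ ∧ x ≠ x₂) ∧
      gap x₁ x₂ σ₁ σ₂ L r x ≤ 0 := fun x => by
    rw [hM, mem_mUp_iff hσ₁ hσ₂ hL hx₁ hx₂, mem_angleDom_iff]
  have mT : ∀ x, x ∈ T ↔ (‖x - x₁‖ ≤ L / σ₁ ∧ ‖x - x₂‖ ≤ L / σ₂ ∧ x ≠ x₁ ∧ x ≠ x₂) ∧
      gap x₁ x₂ σ₁ σ₂ L r x = 0 := fun x => by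
    rw [hT, mem_curveT_iff hσ₁ hσ₂ hL, mem_angleDom_iff]
  have mT' : ∀ x, x ∈ T' ↔ (‖x - x₁‖ ≤ L / σ₁ ∧ ‖x - x₂‖ ≤ L / σ₂ ∧ x ≠ x₁ ∧ x ≠ x₂) ∧
      gap x₁ x₂ σ₁ σ₂ L r x < 0 := fun x => by
    rw [hT', mem_tTilde_iff hσ₁ hσ₂ hL hx₁ hx₂, mem_angleDom_iff]
  have mCl : ∀ x, x ∈ closure M ↔
      ‖x - x₁‖ ≤ L / σ₁ ∧ ‖x - x₂‖ ≤ L / σ₂ ∧ gap x₁ x₂ σ₁ σ₂ L r x ≤ 0 := fun x => by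
    rw [hM, mem_closure_mUp_iff hσ₁ hσ₂ hL hr hx₁ hx₂]
  have g₁ : gap x₁ x₂ σ₁ σ₂ L r x₁ = 0 := gap_left_center hx₁
  have g₂ : gap x₁ x₂ σ₁ σ₂ L r x₂ = 0 := gap_right_center hx₂
  -- With `gap = 0` at the centers, these distances decide which of them are in the closure: `x₁`
  -- when `2r ≤ L/σ₂`, and `x₂` when `2r ≤ L/σ₁`.
  have d₁₁ : ‖x₁ - x₁‖ = 0 := by simp
  have d₂₂ : ‖x₂ - x₂‖ = 0 := by simp
  have d₁₂ : ‖x₁ - x₂‖ = 2 * r := norm_foci_sub hr hx₁ hx₂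
  have d₂₁ : ‖x₂ - x₁‖ = 2 * r := by rw [norm_sub_rev, d₁₂]
  have s₁ : ∀ x, ‖x - x₁‖ = L / σ₁ → (gap x₁ x₂ σ₁ σ₂ L r x < 0 ↔ lam₁ σ₁ σ₂ L r < x 0) :=
    fun x => gap_neg_iff_of_mem_left_sphere hσ₁ hσ₂ hL hr hx₁ hx₂
  have s₂ : ∀ x, ‖x - x₂‖ = L / σ₂ → (gap x₁ x₂ σ₁ σ₂ L r x < 0 ↔ x 0 < lam₂ σ₁ σ₂ L r) :=
    fun x => gap_neg_iff_of_mem_right_sphere hσ₁ hσ₂ hL hr hx₁ hx₂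
  have c₁ : ∀ x, ‖x - x₁‖ ≤ L / σ₁ → lam₁ σ₁ σ₂ L r < x 0 →
      ‖x - x₂‖ < L / σ₂ ∧ gap x₁ x₂ σ₁ σ₂ L r x < 0 :=
    fun x => left_cap hσ₁ hσ₂ hL hr hx₁ hx₂
  have c₂ : ∀ x, ‖x - x₂‖ ≤ L / σ₂ → x 0 < lam₂ σ₁ σ₂ L r →
      ‖x - x₁‖ < L / σ₁ ∧ gap x₁ x₂ σ₁ σ₂ L r x < 0 :=
    fun x => right_cap hσ₁ hσ₂ hL hr hx₁ hx₂
  have mFr : 2 * r < L / σ₁ + L / σ₂ → ∀ x, x ∈ frontier M ↔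
      (‖x - x₁‖ ≤ L / σ₁ ∧ ‖x - x₂‖ ≤ L / σ₂ ∧ gap x₁ x₂ σ₁ σ₂ L r x ≤ 0) ∧
      (‖x - x₁‖ = L / σ₁ ∨ ‖x - x₂‖ = L / σ₂ ∨ gap x₁ x₂ σ₁ σ₂ L r x = 0) := fun htan x => by
    rw [hM]; exact mem_frontier_mUp_iff hσ₁ hσ₂ hL hr hx₁ hx₂ htan
  have mI : 2 * r < L / σ₁ + L / σ₂ → ∀ x, x ∈ interior M ↔
      ‖x - x₁‖ < L / σ₁ ∧ ‖x - x₂‖ < L / σ₂ ∧ gap x₁ x₂ σ₁ σ₂ L r x < 0 := fun htan x => by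
    rw [hM]; exact mem_interior_mUp_iff hσ₁ hσ₂ hL hr hx₁ hx₂ htan
  have q₁ : 2 * r ≤ L / σ₁ → ∀ x, x ≠ x₂ → gap x₁ x₂ σ₁ σ₂ L r x ≤ 0 → ‖x - x₁‖ ≠ L / σ₁ :=
    fun h x => ne_left_radius hσ₁ hσ₂ hL hr hx₁ h
  have q₂ : 2 * r ≤ L / σ₂ → ∀ x, x ≠ x₁ → gap x₁ x₂ σ₁ σ₂ L r x ≤ 0 → ‖x - x₂‖ ≠ L / σ₂ :=
    fun h x => ne_right_radius hσ₁ hσ₂ hL hr hx₂ h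
  have hlam : 2 * r ≤ L / σ₁ + L / σ₂ → lam₂ σ₁ σ₂ L r ≤ lam₁ σ₁ σ₂ L r :=
    lam₂_le_lam₁ hσ₁ hσ₂ hL hr
  rw [ra, rb, rab]
  refine ⟨?_, ?_, ?_, fun h => ?_, fun h => ?_⟩
  rotate_left 3
  · rw [hM, rab']
    exact mUp_eq_singleton hσ₁ hσ₂ hL hx₁ hx₂ (by linarith)
  · rw [hM]
    exact mUp_eq_empty hx₁ hx₂ (by linarith)
  -- The facts collected above carry all the geometry. With `gap`, the abscissas, the radii and the
  -- distances made opaque, each remaining claim is pointwise logic over order relations.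
  all_goals
    clear hM hT hT' hB₁ hB₂ hH₁m hH₂p hx₁ hx₂ ra rb rab rab'
    generalize gap x₁ x₂ σ₁ σ₂ L r = g at *
    generalize lam₁ σ₁ σ₂ L r = l₁ at *
    generalize lam₂ σ₁ σ₂ L r = l₂ at *
    generalize L / σ₁ = a at *
    generalize L / σ₂ = b at *
    obtain ⟨d₁, hd₁⟩ : ∃ d : R n → ℝ, ∀ x, ‖x - x₁‖ = d x := ⟨_, fun _ => rfl⟩
    obtain ⟨d₂, hd₂⟩ : ∃ d : R n → ℝ, ∀ x, ‖x - x₂‖ = d x := ⟨_, fun _ => rfl⟩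
    simp only [hd₁, hd₂] at mF mF' mB mB' mM mT mT' mCl mFr mI q₁ q₂ s₁ s₂ c₁ c₂ d₁₁ d₁₂ d₂₁ d₂₂
    clear hσ₁ hσ₂ hσ hL hd₁ hd₂
  · intro h
    replace q₁ := q₁ (by linarith)
    replace q₂ := q₂ (by linarith)
    replace mFr := mFr (by linarith)
    replace mI := mI (by linarith)
    clear hlam mF mF' mB mB' mH mH' s₁ s₂ c₁ c₂
    have hcl : M ∪ {x₁, x₂} = closure M := by
      ext x
      simp only [Set.mem_union, Set.mem_insert_iff, Set.mem_singleton_iff, mM, mCl]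
      clear mM mT mT' mCl mFr mI q₁ q₂
      grind
    refine ⟨⟨?_, hcl ▸ isClosed_closure⟩, ⟨?_, ?_⟩, ?_⟩
    · rw [Set.disjoint_left]
      simp only [Set.mem_insert_iff, Set.mem_singleton_iff, mM]
      tauto
    · rw [Set.disjoint_left]
      simp only [Set.mem_insert_iff, Set.mem_singleton_iff, mT]
      tauto
    · ext x
      simp only [Set.mem_union, Set.mem_insert_iff, Set.mem_singleton_iff, mFr, mT]
      clear mM mT mT' mCl mFr mI
      grind
    · ext x
      simp only [mI, mT']
      clear mM mT mT' mCl mFr mI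
      grind
  · intro h h'
    replace q₂ := q₂ (by linarith)
    replace mFr := mFr (by linarith)
    replace mI := mI (by linarith)
    clear hlam mF' mB' mH' s₂ c₂ q₁
    have hcl : M ∪ {x₁} = closure M := by
      ext x
      simp only [Set.mem_union, Set.mem_singleton_iff, mM, mCl]
      clear mM mT mT' mCl mFr mI q₂ mF mB mH s₁ c₁
      grind
    refine ⟨⟨?_, hcl ▸ isClosed_closure⟩, ⟨?_, ?_, ?_⟩, ?_, ?_⟩
    · rw [Set.disjoint_left]
      simp only [Set.mem_singleton_iff, mM]
      tauto
    · rw [Set.disjoint_left]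
      simp only [Set.mem_inter_iff, Set.mem_compl_iff, mF, mH, mT]
      intro x
      have := s₁ x
      clear mM mT mT' mCl mFr mI q₂ mF mB mH s₁ c₁
      grind
    · rw [Set.disjoint_left]
      simp only [Set.mem_union, Set.mem_inter_iff, Set.mem_compl_iff, Set.mem_singleton_iff, mF,
        mH, mT]
      clear mM mT mT' mCl mFr mI q₂ mF mB mH s₁ c₁
      grind
    · ext x
      simp only [Set.mem_union, Set.mem_inter_iff, Set.mem_compl_iff, Set.mem_singleton_iff, mFr,
        mF, mH, mT]
      have := s₁ x
      have := c₁ x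
      have := q₂ x
      clear mM mT mT' mCl mFr mI q₂ mF mB mH s₁ c₁
      grind
    · rw [Set.disjoint_left]
      simp only [Set.mem_inter_iff, Set.mem_compl_iff]
      tauto
    · ext x
      simp only [Set.mem_union, Set.mem_inter_iff, Set.mem_compl_iff, mI, mB, mH, mT']
      have := s₁ x
      have := c₁ x
      have := q₂ x
      clear mM mT mT' mCl mFr mI q₂ mF mB mH s₁ c₁
      grind
  · intro h h'
    replace mFr := mFr (by linarith)
    replace mI := mI (by linarith)
    replace hlam := hlam (by linarith)
    clear q₁ q₂
    have hcl : M = closure M := by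
      ext x
      simp only [mM, mCl]
      clear mM mT mT' mCl mFr mI mF mB mH s₁ c₁ mF' mB' mH' s₂ c₂
      grind
    refine ⟨hcl ▸ isClosed_closure, ⟨?_, ?_, ?_⟩, ?_, ?_, ?_⟩
    · rw [Set.disjoint_left]
      simp only [Set.mem_inter_iff, Set.mem_compl_iff, mF, mH, mF', mH']
      intro x
      have := c₁ x
      clear mM mT mT' mCl mFr mI mF mB mH s₁ c₁ mF' mB' mH' s₂ c₂
      grind
    · rw [Set.disjoint_left]
      simp only [Set.mem_union, Set.mem_inter_iff, Set.mem_compl_iff, mF, mH, mF', mH', mT]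
      intro x
      have := s₁ x
      have := s₂ x
      clear mM mT mT' mCl mFr mI mF mB mH s₁ c₁ mF' mB' mH' s₂ c₂
      grind
    · ext x
      simp only [Set.mem_union, Set.mem_inter_iff, Set.mem_compl_iff, mFr, mF, mH, mF', mH', mT]
      have := s₁ x
      have := c₁ x
      have := s₂ x
      have := c₂ x
      clear mM mT mT' mCl mFr mI mF mB mH s₁ c₁ mF' mB' mH' s₂ c₂
      grind
    · rw [Set.disjoint_left]
      simp only [Set.mem_inter_iff, Set.mem_compl_iff, mH, mH']
      clear mM mT mT' mCl mFr mI mF mB mH s₁ c₁ mF' mB' mH' s₂ c₂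
      grind
    · rw [Set.disjoint_left]
      simp only [Set.mem_union, Set.mem_inter_iff, Set.mem_compl_iff]
      tauto
    · ext x
      simp only [Set.mem_union, Set.mem_inter_iff, Set.mem_compl_iff, mI, mB, mH, mB', mH', mT']
      have := s₁ x
      have := c₁ x
      have := s₂ x
      have := c₂ x
      clear mM mT mT' mCl mFr mI mF mB mH s₁ c₁ mF' mB' mH' s₂ c₂
      grind
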